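/- Let $\Gamma$ be a Gromov hyperbolic group that admits a surjective homomorphism $\phi:\Gamma\to\mathbb{Z}^m$, $m\ge 2$, with finitely generated kernel, and let $$P:=\{(g_1,g_2)\in\Gamma\times\Gamma \mid \phi(g_1)=\phi(g_2)\}$$ be the fibre product. Then $P$ is finitely generated, and for every $d\in\mathbb{N}$ there is a sequence $(w_n)_{n\in\mathbb{N}}$ in $P$ such that, for every word length function $|\cdot|_P$ of a finite generating set of $P$: 1. $|w_n|_P\to\infty$ as $n\to\infty$; 2. for every local field $k$ and every representation (group homomorphism) $\rho:P\to\mathrm{GL}_d(k)$ there is a constant $C_\rho>0$ such that for every $n\in\mathbb{N}$ $$\|\mu(\rho(w_n))\|\le C_\rho\,|w_n|_P^{\,1-\frac{1}{2d+3}}.$$ The constant $C_\rho$ may depend on $\rho$, on the word length and on the sequence, but not on $n$; the sequence does not depend on $k$, on $\rho$ or on the word length. Here a local field is $\mathbb{R}$, $\mathbb{C}$, or a non-Archimedean local field (a finite extension of $\mathbb{Q}_p$ or a field $\mathbb{F}_q((T))$ of formal Laurent series over a finite field); $\|\cdot\|$ is the Euclidean norm on $\mathbb{R}^d$; and $\mu(g)=(\log\sigma_1(g),\dots,\log\sigma_d(g))$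 is the Cartan projection, where $\sigma_1(g)\ge\dots\ge\sigma_d(g)$ are the singular values of $g\in\mathrm{GL}_d(k)$. If $k=\mathbb{R}$ or $\mathbb{C}$, these are the square roots of the eigenvalues of $gg^*$. If $k$ is non-Archimedean with ring of integers $\mathcal{O}$, uniformizer $\tau$ and residue field of cardinality $q$, then $\sigma_i(g)=q^{-n_i}$, where $n_1\le\dots\le n_d$ are the integers with $g\in \mathrm{GL}_d(\mathcal{O})\,\mathrm{diag}(\tau^{n_1},\dots,\tau^{n_d})\,\mathrm{GL}_d(\mathcal{O})$. -/

import Mathlib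

open scoped ValuativeRel

noncomputable section

/-- The word length of `g` with respect to a set `S` of generators: the least length of a word in
the letters `S ∪ S⁻¹` that represents `g`. -/
def wordLength {G : Type*} [Group G] (S : Set G) (g : G) : ℕ :=
  sInf {n : ℕ | ∃ l : List G, l.length = n ∧ (∀ x ∈ l, x ∈ S ∨ x⁻¹ ∈ S) ∧ l.prod = g}

/-- The left invariant word metric with respect to a set `S` of generators. -/
def wordDist {G : Type*} [Group G] (S : Set G) (g h : G) : ℕ :=
  wordLength S (g⁻¹ * h)

/-- A group is Gromov hyperbolic if it is finitely generated and, for some finite generating set,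
its word metric satisfies Gromov's four-point condition. -/
def IsGromovHyperbolic (G : Type*) [Group G] : Prop :=
  ∃ S : Set G, S.Finite ∧ Subgroup.closure S = ⊤ ∧
    ∃ δ : ℝ, ∀ x y z w : G,
      (wordDist S x z : ℝ) + wordDist S y w ≤
        max ((wordDist S x y : ℝ) + wordDist S z w) ((wordDist S y z : ℝ) + wordDist S x w) + δ

/-- The (symmetric) fibre product `{(g₁, g₂) | φ g₁ = φ g₂}` of a homomorphism with itself. -/
def fibreProduct {G Q : Type*} [Group G] [Group Q] (φ : G →* Q) : Subgroup (G × G) :=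
  (φ.comp (MonoidHom.fst G G)).eqLocus (φ.comp (MonoidHom.snd G G))

/-- The Cartan projection of `GL_d(k)` for an Archimedean local field `k` (that is, `ℝ` or `ℂ`):
the vector of the logarithms of the singular values, in non-increasing order. -/
def cartanProjArch {k : Type*} [RCLike k] {d : ℕ} (g : GL (Fin d) k) :
    EuclideanSpace ℝ (Fin d) :=
  WithLp.toLp 2 fun i =>
    Real.log ((Matrix.toEuclideanLin (g : Matrix (Fin d) (Fin d) k)).singularValues i)

/-- Smith normal form, over a discrete valuation ring, of a square matrix with nonzero
determinant. -/
theorem exists_smith_form {R : Type*} [CommRing R] [IsDomain R] [IsDiscreteValuationRing R]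
    {τ : R} (hτ : Irreducible τ) {d : ℕ} (A : Matrix (Fin d) (Fin d) R) (hA : A.det ≠ 0) :
    ∃ (m : Fin d → ℕ) (a b : GL (Fin d) R), Monotone m ∧
      A = (a : Matrix (Fin d) (Fin d) R) * Matrix.diagonal (fun i => τ ^ m i) *
        (b : Matrix (Fin d) (Fin d) R) := by
  have hinj : Function.Injective (Matrix.mulVecLin A) := by
    rw [injective_iff_map_eq_zero]
    intro v hv
    exact Matrix.eq_zero_of_mulVec_eq_zero hA (by simpa using hv)
  let e := LinearEquiv.ofInjective (Matrix.mulVecLin A) hinj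
  obtain ⟨b', s, ab', hs⟩ := Submodule.exists_smith_normal_form_of_rank_eq
    (Pi.basisFun R (Fin d)) (N := LinearMap.range (Matrix.mulVecLin A)) e.finrank_eq.symm
  let c := ab'.map e.symm
  have hc : ∀ i, A.mulVec (c i) = s i • b' i := by
    intro i
    rw [← hs i]
    have h1 : (e (c i) : Fin d → R) = ab' i := by simp [c]
    rw [← h1]
    rfl
  have hs0 : ∀ i, s i ≠ 0 := by
    intro i hi
    apply ab'.ne_zero i
    apply Subtype.ext
    rw [hs i, hi, zero_smul]
    rfl
  choose m u hu using fun i =>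
    IsDiscreteValuationRing.eq_unit_mul_pow_irreducible (hs0 i) hτ
  let σ := Tuple.sort m
  let B := b'.reindex σ.symm
  let C := (c.unitsSMul fun i => (u i)⁻¹).reindex σ.symm
  have hBC : ∀ i, A.mulVec (C i) = τ ^ m (σ i) • B i := by
    intro i
    have h1 : C i = ((u (σ i))⁻¹ : Rˣ) • c (σ i) := by
      simp [C, Module.Basis.unitsSMul_apply]
    rw [h1, Units.smul_def, Matrix.mulVec_smul, hc, hu, smul_smul, ← mul_assoc]
    simp [B]
  let E := Pi.basisFun R (Fin d)
  have hmat : A * E.toMatrix C = E.toMatrix B * Matrix.diagonal fun i => τ ^ m (σ i) := by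
    ext i j
    have h1 := congrFun (hBC j) i
    rw [Matrix.mul_diagonal, Matrix.mul_apply]
    simp only [Module.Basis.toMatrix_apply, E, Pi.basisFun_repr]
    simp only [Matrix.mulVec, dotProduct, Pi.smul_apply, smul_eq_mul] at h1
    rw [h1, mul_comm]
  refine ⟨m ∘ σ,
    ⟨E.toMatrix B, B.toMatrix E, E.toMatrix_mul_toMatrix_flip B, B.toMatrix_mul_toMatrix_flip E⟩,
    ⟨C.toMatrix E, E.toMatrix C, C.toMatrix_mul_toMatrix_flip E, E.toMatrix_mul_toMatrix_flip C⟩,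
    Tuple.monotone_sort m, ?_⟩
  change A = E.toMatrix B * (Matrix.diagonal fun i => τ ^ m (σ i)) * C.toMatrix E
  rw [← hmat, Matrix.mul_assoc, E.toMatrix_mul_toMatrix_flip C, Matrix.mul_one]

section NonArchimedean

variable {k : Type*} [Field k] [ValuativeRel k] [TopologicalSpace k] [IsNonarchimedeanLocalField k]

/-- `n₁ ≤ ⋯ ≤ n_d` are the exponents of `g` in the Cartan decomposition
`GL_d(k) = K A⁺ K`, `K = GL_d(𝒪)`, of the general linear group of a non-Archimedean local field `k`:
`g = a · diag(τ ^ n₁, …, τ ^ n_d) · b` with `a, b ∈ GL_d(𝒪)` and `τ` a uniformizer. -/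
def IsCartanExponents {d : ℕ} (g : GL (Fin d) k) (n : Fin d → ℤ) : Prop :=
  Monotone n ∧ ∃ τ : 𝒪[k], Irreducible τ ∧ ∃ a b : GL (Fin d) 𝒪[k],
    (g : Matrix (Fin d) (Fin d) k) =
      (Matrix.GeneralLinearGroup.map (algebraMap 𝒪[k] k) a : Matrix (Fin d) (Fin d) k) *
        Matrix.diagonal (fun i => (τ : k) ^ n i) *
        (Matrix.GeneralLinearGroup.map (algebraMap 𝒪[k] k) b : Matrix (Fin d) (Fin d) k)

theorem exists_isCartanExponents {d : ℕ} (g : GL (Fin d) k) :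
    ∃ n : Fin d → ℤ, IsCartanExponents g n := by
  obtain ⟨τ, hτ⟩ := IsDiscreteValuationRing.exists_irreducible 𝒪[k]
  have hτ0 : (τ : k) ≠ 0 := fun h => hτ.ne_zero (Subtype.ext h)
  obtain ⟨β, hβ⟩ := IsLocalization.exist_integer_multiples_of_finite (nonZeroDivisors 𝒪[k])
    (fun p : Fin d × Fin d => (g : Matrix (Fin d) (Fin d) k) p.1 p.2)
  obtain ⟨N, u, hu⟩ := IsDiscreteValuationRing.eq_unit_mul_pow_irreducible
    (nonZeroDivisors.ne_zero β.2) hτ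
  choose A hA using fun i j => hβ (i, j)
  have hβ0 : (algebraMap 𝒪[k] k) (β : 𝒪[k]) ≠ 0 := by
    simp
  have hAg : (Matrix.of A).map (algebraMap 𝒪[k] k) =
      (algebraMap 𝒪[k] k (β : 𝒪[k])) • (g : Matrix (Fin d) (Fin d) k) := by
    ext i j
    have := hA i j
    simpa [Algebra.smul_def] using this
  have hdet : (Matrix.of A).det ≠ 0 := by
    intro h
    have h1 := congrArg Matrix.det hAg
    rw [← RingHom.mapMatrix_apply, ← RingHom.map_det, h, map_zero, Matrix.det_smul] at h1
    exact mul_ne_zero (pow_ne_zero _ hβ0)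
      ((Matrix.isUnit_iff_isUnit_det _).1 g.isUnit).ne_zero h1.symm
  obtain ⟨m, a, b, hm, hab⟩ := exists_smith_form hτ _ hdet
  refine ⟨fun i => (m i : ℤ) - N, fun i j hij => by simpa using hm hij, τ, hτ, a,
    Matrix.GeneralLinearGroup.mk'' (((u⁻¹ : 𝒪[k]ˣ) : 𝒪[k]) • (b : Matrix (Fin d) (Fin d) 𝒪[k]))
      ?_, ?_⟩
  · rw [Matrix.det_smul]
    exact ((u⁻¹).isUnit.pow _).mul ((Matrix.isUnit_iff_isUnit_det _).1 b.isUnit)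
  · have hg : (g : Matrix (Fin d) (Fin d) k) =
        (algebraMap 𝒪[k] k (β : 𝒪[k]))⁻¹ • (Matrix.of A).map (algebraMap 𝒪[k] k) := by
      rw [hAg, smul_smul, inv_mul_cancel₀ hβ0, one_smul]
    have huu : algebraMap 𝒪[k] k ((u⁻¹ : 𝒪[k]ˣ) : 𝒪[k]) = (algebraMap 𝒪[k] k (u : 𝒪[k]))⁻¹ := by
      refine eq_inv_of_mul_eq_one_left ?_
      rw [← map_mul, Units.inv_mul, map_one]
    have hdiag : Matrix.diagonal (fun i => (τ : k) ^ ((m i : ℤ) - N)) =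
        ((τ : k) ^ N)⁻¹ •
          (Matrix.diagonal (fun i => τ ^ m i)).map (algebraMap 𝒪[k] k) := by
      ext i j
      by_cases h : i = j
      · subst h
        simp only [Matrix.diagonal_apply_eq, Matrix.smul_apply, Matrix.map_apply, map_pow,
          zpow_sub₀ hτ0, zpow_natCast, div_eq_mul_inv, smul_eq_mul]
        exact mul_comm _ _
      · simp [h]
    have hb : ((Matrix.GeneralLinearGroup.map (algebraMap 𝒪[k] k)
        (Matrix.GeneralLinearGroup.mk''
          (((u⁻¹ : 𝒪[k]ˣ) : 𝒪[k]) • (b : Matrix (Fin d) (Fin d) 𝒪[k])) (by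
            rw [Matrix.det_smul]
            exact ((u⁻¹).isUnit.pow _).mul ((Matrix.isUnit_iff_isUnit_det _).1 b.isUnit))) :
          GL (Fin d) k) : Matrix (Fin d) (Fin d) k) =
        (algebraMap 𝒪[k] k (u : 𝒪[k]))⁻¹ •
          (b : Matrix (Fin d) (Fin d) 𝒪[k]).map (algebraMap 𝒪[k] k) := by
      rw [← huu]
      ext i j
      exact map_mul (algebraMap 𝒪[k] k) _ _
    have ha : ((Matrix.GeneralLinearGroup.map (algebraMap 𝒪[k] k) a : GL (Fin d) k) :
        Matrix (Fin d) (Fin d) k) =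
        (a : Matrix (Fin d) (Fin d) 𝒪[k]).map (algebraMap 𝒪[k] k) := rfl
    rw [hb, ha, hdiag, hg, hab, Matrix.map_mul, Matrix.map_mul, hu, map_mul, map_pow]
    simp only [Matrix.mul_smul, Matrix.smul_mul, smul_smul]
    congr 1
    rw [mul_inv]
    rfl

/-- The exponents `n₁ ≤ ⋯ ≤ n_d` of `g` in the Cartan decomposition; they exist by
`exists_isCartanExponents`. -/
def cartanExponents {d : ℕ} (g : GL (Fin d) k) : Fin d → ℤ :=
  (exists_isCartanExponents g).choose

/-- The Cartan projection of `GL_d(k)` for a non-Archimedean local field `k`: the vector of the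
logarithms of the singular values `σᵢ = |τ ^ nᵢ| = q ^ (-nᵢ)`, with `q` the cardinality of the
residue field. -/
def cartanProjNonarch {d : ℕ} (g : GL (Fin d) k) : EuclideanSpace ℝ (Fin d) :=
  WithLp.toLp 2 fun i => Real.log ((Nat.card 𝓀[k] : ℝ) ^ (-cartanExponents g i))

end NonArchimedean

end

/-! ### Word metrics and non-geodesic subwords in hyperbolic groups. -/

section WordMetric

variable {G : Type*} [Group G]

/-! Let a, b ∈ Γ map to two basis vectors of ℤ^m, let D = d!, and let x_n = `twoSquares φ a b D n`,
the commutator in P of ([a^n, b^n], 1) with the diagonal element of a^(-Dn). Up to a shift of the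
index, the sequence is w_n = x_n^n. Its word length is at least of order n³, while log‖ρ(w_n)‖ and
log‖ρ(w_n)⁻¹‖ are O(n²). This gives the exponent 2/3, which is at most 1 - 1/(2d+3) for every d.

Length. The coordinates X, Y of φ send words to lattice paths in the plane, and `areaSum` integrates
|x| dy along them. Replacing a subword of bounded length by a geodesic changes the integral by a
bounded amount, so hyperbolicity gives a linear bound on closed words
(`exists_abs_areaSum_le_of_hyperbolic`). The two projections of a word in P trace the same planar
path. If the word represents (g, 1), its second projection is closed, so the integral is linear in
the length; by its first projection, the integral is also close to that of any other spelling of g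
(`exists_abs_areaSum_le_wordLength`). For x_n the path bounds two squares of opposite orientation on
opposite sides of the line x = 0. Since d(|x| dy) changes sign there, their areas add up to 2n², and
those of w_n to 2n³, against a spelling of length O(n²).

Representations. x_n = (u, 1) lies in the normal subgroup N = ker φ × 1, and y = (1, u) centralizes
N. The product x_n y is the diagonal element of u, a product of O(n) fixed elements, so its
eigenvalues have logarithmic size O(n). On an N-simple subspace, x_n has determinant 1: it is h
times a conjugate of h⁻¹ by c^(Dn), and the determinant character of N is invariant under such
conjugation because the divisibility of D absorbs the permutation of isotypic pieces
(`IsSimpleUnder.det_conj_pow`). As y acts on a copy of that subspace by a scalar, the eigenvalues of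
x_n itself have logarithmic size O(n) (`norm_eigenvalue_bounds`). The norm of x_n is only
exp(O(n²)), but in an n-th power it enters just d times, while the eigenvalues enter n times
(`norm_pow_le_of_eigenvalues`); the total is exp(O(n²)). -/

theorem exists_list_length_eq_wordLength {S : Set G} (hS : Subgroup.closure S = ⊤) (g : G) :
    ∃ l : List G, l.length = wordLength S g ∧ (∀ x ∈ l, x ∈ S ∨ x⁻¹ ∈ S) ∧ l.prod = g := by
  have hne : {n : ℕ | ∃ l : List G, l.length = n ∧ (∀ x ∈ l, x ∈ S ∨ x⁻¹ ∈ S) ∧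
      l.prod = g}.Nonempty := by
    have hg : g ∈ Submonoid.closure (S ∪ S⁻¹) := by
      rw [← Subgroup.closure_toSubmonoid, hS]
      exact Subgroup.mem_top g
    obtain ⟨l, hl, hg⟩ := Submonoid.exists_list_of_mem_closure hg
    exact ⟨_, l, rfl, hl, hg⟩
  exact Nat.sInf_mem hne

theorem wordLength_prod_le {S : Set G} (l : List G) (hl : ∀ x ∈ l, x ∈ S ∨ x⁻¹ ∈ S) :
    wordLength S l.prod ≤ l.length :=
  Nat.sInf_le ⟨l, rfl, hl, rfl⟩

theorem wordLength_inv {S : Set G} (hS : Subgroup.closure S = ⊤) (g : G) :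
    wordLength S g⁻¹ = wordLength S g := by
  have key : ∀ g : G, wordLength S g⁻¹ ≤ wordLength S g := by
    intro g
    obtain ⟨l, hlen, hl, rfl⟩ := exists_list_length_eq_wordLength hS g
    rw [List.prod_inv_reverse, ← hlen]
    refine (wordLength_prod_le _ ?_).trans (by simp)
    intro x hx
    simp only [List.mem_reverse, List.mem_map] at hx
    obtain ⟨y, hy, rfl⟩ := hx
    simpa using (hl y hy).symm
  exact le_antisymm (key g) (by simpa using key g⁻¹)

/-- In a hyperbolic group long closed words contain a subword of bounded length that is not
geodesic. -/
theorem exists_shortening {S : Set G} (hS : Subgroup.closure S = ⊤) {δ : ℝ}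
    (hδ : ∀ x y z w : G,
      (wordDist S x z : ℝ) + wordDist S y w ≤
        max ((wordDist S x y : ℝ) + wordDist S z w) ((wordDist S y z : ℝ) + wordDist S x w) + δ)
    {r : ℕ} (hr : δ < r) (l : List G) (hl : ∀ x ∈ l, x ∈ S ∨ x⁻¹ ∈ S)
    (h1 : l.prod = 1) (hlen : 4 * r ≤ l.length) (hr1 : 1 ≤ r) :
    ∃ l₁ m l₂ : List G, l = l₁ ++ m ++ l₂ ∧ m.length ≤ 2 * r ∧ wordLength S m.prod < m.length := by
  by_contra! hcon
  set p : ℕ → G := fun i => (l.take i).prod with hp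
  -- The negated claim says that every subword of length at most 2r is geodesic.
  have hdist : ∀ i j, i ≤ j → j ≤ l.length → j - i ≤ 2 * r → wordDist S (p i) (p j) = j - i := by
    intro i j hij hj hji
    have hsplit : l = l.take i ++ (l.drop i).take (j - i) ++ (l.drop i).drop (j - i) := by
      rw [List.append_assoc, List.take_append_drop, List.take_append_drop]
    have hml : ((l.drop i).take (j - i)).length = j - i := by
      simp only [List.length_take, List.length_drop]; omega
    have hpj : p j = p i * ((l.drop i).take (j - i)).prod := by
      simp only [hp, ← List.prod_append]
      congr 1
      rw [← List.take_add]
      congr 1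
      omega
    have hd : wordDist S (p i) (p j) = wordLength S ((l.drop i).take (j - i)).prod := by
      rw [wordDist, hpj, inv_mul_cancel_left]
    rw [hd]
    refine le_antisymm ?_ ?_
    · refine (wordLength_prod_le _ fun x hx => hl x ?_).trans hml.le
      exact List.mem_of_mem_drop (List.mem_of_mem_take hx)
    · have := hcon _ _ _ hsplit (by omega)
      omega
  have hd1 : ∀ i, wordDist S 1 (p i) = wordLength S (p i) := fun i => by simp [wordDist]
  have hp0 : p 0 = 1 := by simp [hp]
  -- The prefix farthest from 1. Its distance is at least 2r, which keeps it r steps away from both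
  -- ends of the closed word.
  obtain ⟨t, ht, hmax⟩ := Finset.exists_max_image (Finset.range (l.length + 1))
    (fun i => wordLength S (p i)) ⟨0, by simp⟩
  simp only [Finset.mem_range] at ht hmax
  have h2r : wordLength S (p (2 * r)) = 2 * r := by
    have := hdist 0 (2 * r) (by omega) (by omega) (by omega)
    rw [hp0, hd1] at this
    omega
  have hmax2 := hmax (2 * r) (by omega)
  have htr : r ≤ t := by
    by_contra! h
    have : wordLength S (p t) ≤ t := by
      refine (wordLength_prod_le _ fun x hx => hl x (List.mem_of_mem_take hx)).trans ?_
      simp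
    omega
  have htr' : t + r ≤ l.length := by
    by_contra! h
    have : wordLength S (p t) ≤ l.length - t := by
      have h3 : p t = ((l.drop t).prod)⁻¹ := by
        rw [eq_inv_iff_mul_eq_one, ← h1, hp]
        simp only [← List.prod_append, List.take_append_drop]
      rw [h3, wordLength_inv hS]
      refine (wordLength_prod_le _ fun x hx => hl x (List.mem_of_mem_drop hx)).trans ?_
      simp
    omega
  -- At the farthest point the path cannot run straight for r steps on both sides: the four-point
  -- condition would give r ≤ δ.
  have h4 := hδ 1 (p (t - r)) (p t) (p (t + r))
  rw [hd1, hd1, hd1, hdist (t - r) (t + r) (by omega) htr' (by omega),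
    hdist t (t + r) (by omega) htr' (by omega), hdist (t - r) t (by omega) (by omega) (by omega)]
    at h4
  have e1 : t + r - (t - r) = 2 * r := by omega
  have e2 : t + r - t = r := by omega
  have e3 : t - (t - r) = r := by omega
  rw [e1, e2, e3] at h4
  have m1 : (wordLength S (p (t - r)) : ℝ) ≤ wordLength S (p t) := by
    exact_mod_cast hmax (t - r) (by omega)
  have m2 : (wordLength S (p (t + r)) : ℝ) ≤ wordLength S (p t) := by
    exact_mod_cast hmax (t + r) (by omega)
  have h5 : max ((wordLength S (p (t - r)) : ℝ) + r) ((r : ℝ) + wordLength S (p (t + r))) ≤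
      wordLength S (p t) + r := max_le (by linarith) (by linarith)
  push_cast at h4
  linarith

end WordMetric

/-! ### The integral of |x| dy and the linear isoperimetric inequality. -/

section AreaSum

variable {G : Type*}

/-- The integral of the one-form `|x| dy` along the path in the plane that starts on the line
`x = ξ` and whose successive steps are the images `(X s, Y s)` of the letters of a word
(with the integrand evaluated at the beginning of each step). -/
def areaSum (X Y : G → ℤ) : ℤ → List G → ℤ
  | _, [] => 0
  | ξ, s :: l => |ξ| * Y s + areaSum X Y (ξ + X s) l

variable {X Y : G → ℤ}

theorem areaSum_map_eq {H : Type*} {f g : H → G} (hX : ∀ p, X (f p) = X (g p))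
    (hY : ∀ p, Y (f p) = Y (g p)) (ξ : ℤ) (l : List H) :
    areaSum X Y ξ (l.map f) = areaSum X Y ξ (l.map g) := by
  induction l generalizing ξ with
  | nil => rfl
  | cons s l ih => simp [areaSum, ih, hX, hY]

theorem areaSum_replicate_of_horizontal {s : G} (hs : Y s = 0) (n : ℕ) (ξ : ℤ) :
    areaSum X Y ξ (List.replicate n s) = 0 := by
  induction n generalizing ξ with
  | zero => rfl
  | succ n ih => simp [List.replicate_succ, areaSum, ih, hs]

theorem areaSum_replicate_of_vertical {s : G} (hs : X s = 0) (n : ℕ) (ξ : ℤ) :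
    areaSum X Y ξ (List.replicate n s) = n * (|ξ| * Y s) := by
  induction n generalizing ξ with
  | zero => simp [areaSum]
  | succ n ih => simp [List.replicate_succ, areaSum, ih, hs]; ring

variable [Group G]

theorem map_one_of_additive (hX : ∀ g h, X (g * h) = X g + X h) : X 1 = 0 := by
  have := hX 1 1
  rw [mul_one] at this
  omega

theorem areaSum_append (hX : ∀ g h, X (g * h) = X g + X h) (ξ : ℤ) (l l' : List G) :
    areaSum X Y ξ (l ++ l') = areaSum X Y ξ l + areaSum X Y (ξ + X l.prod) l' := by
  induction l generalizing ξ with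
  | nil => simp [areaSum, map_one_of_additive hX]
  | cons s l ih => simp [areaSum, ih, hX, add_assoc]

theorem abs_map_prod_le (hY : ∀ g h, Y (g * h) = Y g + Y h) {M : ℤ} (l : List G)
    (hM : ∀ s ∈ l, |Y s| ≤ M) : |Y l.prod| ≤ M * l.length := by
  induction l with
  | nil => simp [map_one_of_additive hY]
  | cons s l ih =>
    have h1 := ih fun t ht => hM t (by simp [ht])
    have h2 := hM s (by simp)
    have h3 := abs_add_le (Y s) (Y l.prod)
    simp only [List.prod_cons, hY, List.length_cons]
    push_cast
    linarith

/-- The weight |x| is 1-Lipschitz, so freezing it at its initial value costs at most M per step,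
multiplied by the Y-displacement still to come. The bound does not involve ξ, so it can be used on a
subword anywhere in the plane. -/
theorem abs_areaSum_sub_le (hY : ∀ g h, Y (g * h) = Y g + Y h) {M : ℤ} (ξ : ℤ) (l : List G)
    (hMX : ∀ s ∈ l, |X s| ≤ M) (hMY : ∀ s ∈ l, |Y s| ≤ M) :
    |areaSum X Y ξ l - |ξ| * Y l.prod| ≤ M ^ 2 * (l.length : ℤ) ^ 2 := by
  induction l generalizing ξ with
  | nil => simp [areaSum, map_one_of_additive hY]
  | cons s l ih =>
    have h1 := ih (ξ + X s) (fun t ht => hMX t (by simp [ht])) fun t ht => hMY t (by simp [ht])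
    have h2 := abs_map_prod_le hY l (M := M) fun t ht => hMY t (by simp [ht])
    have h3 := hMX s (by simp)
    have hM : 0 ≤ M := (abs_nonneg _).trans h3
    have h4 : |(|ξ + X s| - |ξ|)| ≤ M := by
      refine (abs_abs_sub_abs_le _ _).trans ?_
      simpa using h3
    have h5 : |(|ξ + X s| - |ξ|) * Y l.prod| ≤ M * (M * l.length) := by
      rw [abs_mul]
      exact mul_le_mul h4 h2 (abs_nonneg _) hM
    have h6 : areaSum X Y ξ (s :: l) - |ξ| * Y (s :: l).prod =
        (areaSum X Y (ξ + X s) l - |ξ + X s| * Y l.prod) + (|ξ + X s| - |ξ|) * Y l.prod := by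
      simp only [areaSum, List.prod_cons, hY]
      ring
    rw [h6]
    refine (abs_add_le _ _).trans ((add_le_add h1 h5).trans ?_)
    simp only [List.length_cons]
    push_cast
    have : (0 : ℤ) ≤ l.length := by positivity
    nlinarith [mul_nonneg (sq_nonneg M) this, sq_nonneg M]

/-- The linear isoperimetric inequality of a hyperbolic group, for the functional `areaSum`. -/
theorem exists_abs_areaSum_le_of_hyperbolic {S : Set G}
    (hS : Subgroup.closure S = ⊤) {δ : ℝ}
    (hδ : ∀ x y z w : G,
      (wordDist S x z : ℝ) + wordDist S y w ≤
        max ((wordDist S x y : ℝ) + wordDist S z w) ((wordDist S y z : ℝ) + wordDist S x w) + δ)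
    (hX : ∀ g h, X (g * h) = X g + X h) (hY : ∀ g h, Y (g * h) = Y g + Y h) {M : ℤ}
    (hMX : ∀ s, s ∈ S ∨ s⁻¹ ∈ S → |X s| ≤ M) (hMY : ∀ s, s ∈ S ∨ s⁻¹ ∈ S → |Y s| ≤ M) :
    ∃ C : ℤ, 0 ≤ C ∧ ∀ (ξ : ℤ) (l : List G), (∀ x ∈ l, x ∈ S ∨ x⁻¹ ∈ S) → l.prod = 1 →
      |areaSum X Y ξ l| ≤ C * l.length := by
  obtain ⟨r₀, hr₀⟩ := exists_nat_gt δ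
  set r := r₀ + 1 with hrdef
  have hr : δ < r := hr₀.trans (by rw [hrdef]; push_cast; linarith)
  -- A subword of length at most 2r and its geodesic replacement each deviate by at most M²(2r)²,
  -- and the replacement saves at least one letter.
  refine ⟨8 * (M * r) ^ 2, by positivity, fun ξ l => ?_⟩
  induction hn : l.length using Nat.strong_induction_on generalizing ξ l with
  | _ n ih =>
    intro hl h1
    subst hn
    rcases lt_or_ge l.length (4 * r) with hlt | hge
    · have h2 := abs_areaSum_sub_le (X := X) hY ξ l (fun s hs => hMX s (hl s hs))
        fun s hs => hMY s (hl s hs)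
      rw [h1, map_one_of_additive hY, mul_zero, sub_zero] at h2
      refine h2.trans ?_
      have h3 : (l.length : ℤ) ≤ 8 * (r : ℤ) ^ 2 := by
        have : (l.length : ℤ) ≤ 4 * r := by exact_mod_cast hlt.le
        have : (1 : ℤ) ≤ r := by rw [hrdef]; push_cast; linarith
        nlinarith
      calc M ^ 2 * (l.length : ℤ) ^ 2 = M ^ 2 * l.length * l.length := by ring
        _ ≤ M ^ 2 * (8 * (r : ℤ) ^ 2) * l.length := by gcongr
        _ = _ := by ring
    · obtain ⟨l₁, m, l₂, rfl, hm2r, hshort⟩ := exists_shortening hS hδ hr l hl h1 hge (by omega)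
      obtain ⟨m', hm'len, hm', hm'prod⟩ := exists_list_length_eq_wordLength hS m.prod
      have hlt : m'.length < m.length := by omega
      have hmS : ∀ s ∈ m, s ∈ S ∨ s⁻¹ ∈ S := fun s hs => hl s (by simp [hs])
      have h3 := ih (l₁ ++ m' ++ l₂).length (by simp; omega) ξ (l₁ ++ m' ++ l₂) rfl
        (by
          intro s hs
          simp only [List.mem_append] at hs
          rcases hs with (hs | hs) | hs
          · exact hl s (by simp [hs])
          · exact hm' s hs
          · exact hl s (by simp [hs]))
        (by simpa [hm'prod] using h1)
      have e1 : areaSum X Y ξ (l₁ ++ m ++ l₂) = areaSum X Y ξ (l₁ ++ m' ++ l₂) +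
          (areaSum X Y (ξ + X l₁.prod) m - areaSum X Y (ξ + X l₁.prod) m') := by
        simp only [areaSum_append hX, List.prod_append, hm'prod]
        ring
      have e2 := abs_areaSum_sub_le (X := X) hY (ξ + X l₁.prod) m (fun s hs => hMX s (hmS s hs))
        fun s hs => hMY s (hmS s hs)
      have e3 := abs_areaSum_sub_le (X := X) hY (ξ + X l₁.prod) m' (fun s hs => hMX s (hm' s hs))
        fun s hs => hMY s (hm' s hs)
      rw [hm'prod] at e3
      have b1 : M ^ 2 * (m.length : ℤ) ^ 2 ≤ M ^ 2 * (2 * r) ^ 2 := by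
        gcongr
        exact_mod_cast hm2r
      have b2 : M ^ 2 * (m'.length : ℤ) ^ 2 ≤ M ^ 2 * (2 * r) ^ 2 := by
        gcongr
        exact_mod_cast (hlt.le.trans hm2r)
      have b3 : 8 * (M * r) ^ 2 * ((l₁ ++ m' ++ l₂).length : ℤ) + 8 * (M * r) ^ 2 ≤
          8 * (M * r) ^ 2 * ((l₁ ++ m ++ l₂).length : ℤ) := by
        have : ((l₁ ++ m' ++ l₂).length : ℤ) + 1 ≤ ((l₁ ++ m ++ l₂).length : ℤ) := by
          simp only [List.length_append]
          push_cast
          omega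
        have h0 : 0 ≤ 8 * (M * r) ^ 2 := by positivity
        nlinarith
      rw [e1]
      rw [abs_le] at *
      constructor <;> nlinarith

/-- Generalization to words in any finite set of letters. -/
theorem exists_abs_areaSum_le (hG : IsGromovHyperbolic G)
    (hX : ∀ g h, X (g * h) = X g + X h) (hY : ∀ g h, Y (g * h) = Y g + Y h) {T : Set G}
    (hT : T.Finite) :
    ∃ C : ℤ, 0 ≤ C ∧ ∀ (ξ : ℤ) (l : List G), (∀ x ∈ l, x ∈ T) → l.prod = 1 →
      |areaSum X Y ξ l| ≤ C * l.length := by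
  obtain ⟨S, hSf, hS, δ, hδ⟩ := hG
  have hS' : {s : G | s ∈ S ∨ s⁻¹ ∈ S}.Finite := hSf.union hSf.inv
  obtain ⟨M₁, hM₁⟩ := (hS'.image fun s => |X s|).bddAbove
  obtain ⟨M₂, hM₂⟩ := (hS'.image fun s => |Y s|).bddAbove
  obtain ⟨B, hB⟩ := (hT.image fun s => wordLength S s).bddAbove
  have hMX : ∀ s, s ∈ S ∨ s⁻¹ ∈ S → |X s| ≤ max M₁ M₂ := fun s hs =>
    (hM₁ ⟨s, hs, rfl⟩).trans (le_max_left _ _)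
  have hMY : ∀ s, s ∈ S ∨ s⁻¹ ∈ S → |Y s| ≤ max M₁ M₂ := fun s hs =>
    (hM₂ ⟨s, hs, rfl⟩).trans (le_max_right _ _)
  obtain ⟨C, hC0, hC⟩ := exists_abs_areaSum_le_of_hyperbolic hS hδ hX hY hMX hMY
  set M := max M₁ M₂
  choose W hWlen hWS hWprod using exists_list_length_eq_wordLength hS
  have hprod : ∀ l : List G, (l.flatMap W).prod = l.prod := by
    intro l
    induction l with
    | nil => rfl
    | cons s l ih => simp [ih, hWprod]
  have hlen : ∀ l : List G, (∀ x ∈ l, x ∈ T) → (l.flatMap W).length ≤ B * l.length := by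
    intro l hl
    induction l with
    | nil => simp
    | cons s l ih =>
      have h1 := ih fun x hx => hl x (by simp [hx])
      have h2 : (W s).length ≤ B := (hWlen s).trans_le (hB ⟨s, hl s (by simp), rfl⟩)
      simp only [List.flatMap_cons, List.length_append, List.length_cons]
      linarith
  -- Respelling one letter keeps its endpoints, hence changes the integral by at most M²B², and
  -- leaves the later letters in place.
  have hdiff : ∀ (l : List G) (ξ : ℤ), (∀ x ∈ l, x ∈ T) →
      |areaSum X Y ξ (l.flatMap W) - areaSum X Y ξ l| ≤ M ^ 2 * (B : ℤ) ^ 2 * l.length := by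
    intro l
    induction l with
    | nil => simp [areaSum]
    | cons s l ih =>
      intro ξ hl
      have h1 := ih (ξ + X s) fun x hx => hl x (by simp [hx])
      have h2 := abs_areaSum_sub_le (X := X) hY ξ (W s) (fun t ht => hMX t (hWS s t ht))
        fun t ht => hMY t (hWS s t ht)
      have h3 : M ^ 2 * ((W s).length : ℤ) ^ 2 ≤ M ^ 2 * (B : ℤ) ^ 2 := by
        gcongr
        exact (hWlen s).trans_le (hB ⟨s, hl s (by simp), rfl⟩)
      rw [hWprod] at h2
      have e1 : areaSum X Y ξ ((s :: l).flatMap W) - areaSum X Y ξ (s :: l) =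
          (areaSum X Y ξ (W s) - |ξ| * Y s) +
            (areaSum X Y (ξ + X s) (l.flatMap W) - areaSum X Y (ξ + X s) l) := by
        simp only [List.flatMap_cons, areaSum_append hX, hWprod, areaSum]
        ring
      rw [e1]
      refine (abs_add_le _ _).trans ((add_le_add (h2.trans h3) h1).trans (le_of_eq ?_))
      simp only [List.length_cons]
      push_cast
      ring
  refine ⟨C * B + M ^ 2 * (B : ℤ) ^ 2, by positivity, fun ξ l hl h1 => ?_⟩
  have h2 := hC ξ (l.flatMap W)
    (fun x hx => by
      obtain ⟨s, -, hs⟩ := List.mem_flatMap.1 hx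
      exact hWS s x hs)
    ((hprod l).trans h1)
  have h3 := hdiff l ξ hl
  have h4 : C * ((l.flatMap W).length : ℤ) ≤ C * (B * l.length) := by
    gcongr
    exact_mod_cast hlen l hl
  rw [abs_le] at *
  constructor <;> nlinarith

/-- Both words become closed after appending the inverse of `l'`; the appended part starts on the
same line in both cases, so its contribution cancels. -/
theorem exists_abs_areaSum_sub_le (hG : IsGromovHyperbolic G)
    (hX : ∀ g h, X (g * h) = X g + X h) (hY : ∀ g h, Y (g * h) = Y g + Y h) {T : Set G}
    (hT : T.Finite) :
    ∃ C : ℤ, 0 ≤ C ∧ ∀ (ξ : ℤ) (l l' : List G), (∀ x ∈ l, x ∈ T) → (∀ x ∈ l', x ∈ T) →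
      l.prod = l'.prod → |areaSum X Y ξ l - areaSum X Y ξ l'| ≤ C * (l.length + l'.length) := by
  obtain ⟨C, hC0, hC⟩ := exists_abs_areaSum_le hG hX hY (hT.union hT.inv)
  refine ⟨3 * C, by positivity, fun ξ l l' hl hl' h => ?_⟩
  set v := (l'.map (·⁻¹)).reverse with hv
  have hvprod : v.prod = l'.prod⁻¹ := (List.prod_inv_reverse l').symm
  have hvlen : v.length = l'.length := by simp [hv]
  have hvT : ∀ x ∈ v, x ∈ T ∪ T⁻¹ := by
    intro x hx
    simp only [hv, List.mem_reverse, List.mem_map] at hx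
    obtain ⟨y, hy, rfl⟩ := hx
    exact Or.inr (by simpa using hl' y hy)
  have h1 := hC ξ (l ++ v)
    (fun x hx => (List.mem_append.1 hx).elim (fun h => Or.inl (hl x h)) (hvT x))
    (by rw [List.prod_append, hvprod, h, mul_inv_cancel])
  have h2 := hC ξ (l' ++ v)
    (fun x hx => (List.mem_append.1 hx).elim (fun h => Or.inl (hl' x h)) (hvT x))
    (by rw [List.prod_append, hvprod, mul_inv_cancel])
  rw [areaSum_append hX, List.length_append, hvlen] at h1 h2
  rw [h] at h1
  push_cast at h1 h2
  have h0 : 0 ≤ C * (l.length : ℤ) := by positivity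
  rw [abs_le] at *
  constructor <;> nlinarith

/-- Elements `(g, 1)` of a subgroup of `G × G` on which the two projections have the same image
under `X` and `Y` have large word length if `g` encloses a large area. -/
theorem exists_abs_areaSum_le_wordLength (hG : IsGromovHyperbolic G)
    (hX : ∀ g h, X (g * h) = X g + X h) (hY : ∀ g h, Y (g * h) = Y g + Y h)
    {P : Subgroup (G × G)} (hPX : ∀ p : P, X p.1.1 = X p.1.2) (hPY : ∀ p : P, Y p.1.1 = Y p.1.2)
    {S : Set P} (hSf : S.Finite) (hS : Subgroup.closure S = ⊤) {T : Set G} (hT : T.Finite) :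
    ∃ C : ℤ, 0 ≤ C ∧ ∀ (p : P) (v : List G), p.1.2 = 1 → (∀ x ∈ v, x ∈ T) → v.prod = p.1.1 →
      |areaSum X Y 0 v| ≤ C * (wordLength S p + v.length) := by
  have hS' : {s : P | s ∈ S ∨ s⁻¹ ∈ S}.Finite := hSf.union hSf.inv
  set T₁ := (fun s : P => s.1.1) '' {s : P | s ∈ S ∨ s⁻¹ ∈ S} with hT₁
  set T₂ := (fun s : P => s.1.2) '' {s : P | s ∈ S ∨ s⁻¹ ∈ S} with hT₂
  obtain ⟨C₁, hC₁0, hC₁⟩ := exists_abs_areaSum_sub_le hG hX hY ((hS'.image _).union hT :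
    (T₁ ∪ T).Finite)
  obtain ⟨C₂, hC₂0, hC₂⟩ := exists_abs_areaSum_le hG hX hY (hS'.image _ : T₂.Finite)
  refine ⟨C₁ + C₂, by positivity, fun p v hp hv hvp => ?_⟩
  obtain ⟨l, hlen, hl, rfl⟩ := exists_list_length_eq_wordLength hS p
  have hfst : (l.map fun s : P => s.1.1).prod = l.prod.1.1 :=
    ((MonoidHom.fst G G).comp P.subtype).map_list_prod l |>.symm
  have hsnd : (l.map fun s : P => s.1.2).prod = l.prod.1.2 :=
    ((MonoidHom.snd G G).comp P.subtype).map_list_prod l |>.symm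
  have h1 := hC₁ 0 (l.map fun s : P => s.1.1) v
    (fun x hx => by
      obtain ⟨s, hs, rfl⟩ := List.mem_map.1 hx
      exact Or.inl ⟨s, hl s hs, rfl⟩)
    (fun x hx => Or.inr (hv x hx)) (hfst.trans hvp.symm)
  have h2 := hC₂ 0 (l.map fun s : P => s.1.2)
    (fun x hx => by
      obtain ⟨s, hs, rfl⟩ := List.mem_map.1 hx
      exact ⟨s, hl s hs, rfl⟩)
    (hsnd.trans hp)
  -- The integral sees only X and Y, so the first projection may be exchanged for the second, which
  -- is a closed word.
  rw [areaSum_map_eq hPX hPY] at h1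
  rw [← hlen]
  simp only [List.length_map] at h1 h2
  have h0 : 0 ≤ C₂ * (v.length : ℤ) := by positivity
  rw [abs_le] at *
  constructor <;> nlinarith

theorem areaSum_flatten_replicate (hX : ∀ g h, X (g * h) = X g + X h) {U : List G}
    (hU : X U.prod = 0) (n : ℕ) (ξ : ℤ) :
    areaSum X Y ξ (List.replicate n U).flatten = n * areaSum X Y ξ U := by
  induction n with
  | zero => simp [areaSum]
  | succ n ih =>
    rw [List.replicate_succ, List.flatten_cons, areaSum_append hX, hU, add_zero, ih]
    push_cast
    ring

end AreaSum

/-! ### Clifford theory for a normal subgroup. -/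

section Representation

variable {K V G : Type*} [Field K] [AddCommGroup V] [Module K V] [Group G]

/-- `U` is invariant under the operators `ρ g`, `g ∈ N`. -/
def IsInvariantUnder (ρ : Representation K G V) (N : Subgroup G) (U : Submodule K V) : Prop :=
  ∀ g ∈ N, ∀ v ∈ U, ρ g v ∈ U

/-- `U` is a minimal nonzero subspace invariant under the operators `ρ g`, `g ∈ N`. -/
structure IsSimpleUnder (ρ : Representation K G V) (N : Subgroup G) (U : Submodule K V) :
    Prop where
  invariant : IsInvariantUnder ρ N U
  ne_bot : U ≠ ⊥
  eq_of_le : ∀ W ≤ U, W ≠ ⊥ → IsInvariantUnder ρ N W → W = U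

variable {ρ : Representation K G V} {N : Subgroup G} {U W : Submodule K V}

theorem IsInvariantUnder.sup (hU : IsInvariantUnder ρ N U) (hW : IsInvariantUnder ρ N W) :
    IsInvariantUnder ρ N (U ⊔ W) := by
  intro g hg v hv
  obtain ⟨u, hu, w, hw, rfl⟩ := Submodule.mem_sup.1 hv
  rw [map_add]
  exact Submodule.add_mem_sup (hU g hg u hu) (hW g hg w hw)

theorem IsInvariantUnder.inf (hU : IsInvariantUnder ρ N U) (hW : IsInvariantUnder ρ N W) :
    IsInvariantUnder ρ N (U ⊓ W) := fun g hg v hv => ⟨hU g hg v hv.1, hW g hg v hv.2⟩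

theorem IsInvariantUnder.map [N.Normal] (hU : IsInvariantUnder ρ N U) (c : G) :
    IsInvariantUnder ρ N (U.map (ρ c)) := by
  rintro g hg _ ⟨u, hu, rfl⟩
  refine ⟨ρ (c⁻¹ * g * c) u, hU _ ?_ u hu, ?_⟩
  · simpa using (inferInstance : N.Normal).conj_mem g hg c⁻¹
  · simp only [← Module.End.mul_apply, ← map_mul]
    congr 2
    group

theorem representation_apply_apply (ρ : Representation K G V) (a b : G) (v : V) :
    ρ a (ρ b v) = ρ (a * b) v := by rw [map_mul, Module.End.mul_apply]

theorem representation_inv_apply (ρ : Representation K G V) (a : G) (v : V) :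
    ρ a⁻¹ (ρ a v) = v := by
  rw [representation_apply_apply, inv_mul_cancel, map_one, Module.End.one_apply]

theorem map_representation_ne_bot (hU : U ≠ ⊥) (c : G) : U.map (ρ c) ≠ ⊥ := by
  intro h
  apply hU
  rw [eq_bot_iff]
  intro u hu
  have h1 : ρ c u ∈ U.map (ρ c) := ⟨u, hu, rfl⟩
  rw [h, Submodule.mem_bot] at h1
  have h2 := representation_inv_apply ρ c u
  rw [h1, map_zero] at h2
  exact h2.symm

theorem map_map_representation_inv (c : G) (U : Submodule K V) :
    (U.map (ρ c)).map (ρ c⁻¹) = U := by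
  rw [← Submodule.map_comp]
  have : ρ c⁻¹ ∘ₗ ρ c = LinearMap.id := LinearMap.ext (representation_inv_apply ρ c)
  rw [this, Submodule.map_id]

theorem IsSimpleUnder.map [N.Normal] (hU : IsSimpleUnder ρ N U) (c : G) :
    IsSimpleUnder ρ N (U.map (ρ c)) where
  invariant := hU.invariant.map c
  ne_bot := map_representation_ne_bot hU.ne_bot c
  eq_of_le := by
    intro W hW hW0 hWi
    have h1 := hU.eq_of_le (W.map (ρ c⁻¹))
      ((Submodule.map_mono hW).trans (map_map_representation_inv c U).le)
      (map_representation_ne_bot hW0 c⁻¹) (hWi.map c⁻¹)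
    have h2 := map_map_representation_inv (ρ := ρ) c⁻¹ W
    rw [h1, inv_inv] at h2
    exact h2.symm

theorem IsSimpleUnder.le_of_inf_ne_bot (hU : IsSimpleUnder ρ N U) (hW : IsInvariantUnder ρ N W)
    (h : U ⊓ W ≠ ⊥) : U ≤ W :=
  inf_eq_left.1 (hU.eq_of_le _ inf_le_left h (hU.invariant.inf hW))

theorem exists_isSimpleUnder [FiniteDimensional K V] (hW0 : W ≠ ⊥)
    (hW : IsInvariantUnder ρ N W) : ∃ U ≤ W, IsSimpleUnder ρ N U := by
  obtain ⟨U, ⟨hUW, hU0, hUi⟩, hmin⟩ := (measure fun U : Submodule K V => Module.finrank K U).wf.has_min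
    {U | U ≤ W ∧ U ≠ ⊥ ∧ IsInvariantUnder ρ N U} ⟨W, le_rfl, hW0, hW⟩
  refine ⟨U, hUW, hUi, hU0, fun W' hW'U hW'0 hW'i => ?_⟩
  refine Submodule.eq_of_le_of_finrank_le hW'U (not_lt.1 ?_)
  exact hmin W' ⟨hW'U.trans hUW, hW'0, hW'i⟩

/-- Among the translates `c ^ j U`, `j ≤ dim V`, of a simple subspace two are isomorphic. This is
expressed by an injective endomorphism of `U` that intertwines two conjugate actions. -/
theorem IsSimpleUnder.exists_intertwiner [FiniteDimensional K V] [N.Normal]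
    (hU : IsSimpleUnder ρ N U) (c : G) :
    ∃ i j : ℕ, i < j ∧ j ≤ Module.finrank K V ∧ ∃ F : U →ₗ[K] U, Function.Injective F ∧
      ∀ g ∈ N, ∀ u u' : U, (u' : V) = ρ ((c ^ j)⁻¹ * g * c ^ j) u →
        (F u' : V) = ρ ((c ^ i)⁻¹ * g * c ^ i) (F u) := by
  set T : ℕ → Submodule K V := fun j => U.map (ρ (c ^ j)) with hT
  set W : ℕ → Submodule K V := fun j => (Finset.range j).sup T with hW
  have hTs : ∀ j, IsSimpleUnder ρ N (T j) := fun j => hU.map _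
  have hWsucc : ∀ j, W (j + 1) = T j ⊔ W j := fun j => by
    simp only [hW, Finset.range_add_one, Finset.sup_insert]
  have hW0 : W 0 = ⊥ := by simp [hW]
  have hWi : ∀ j, IsInvariantUnder ρ N (W j) := by
    intro j
    induction j with
    | zero => rw [hW0]; intro g _ v hv; simp_all
    | succ j ih => rw [hWsucc]; exact (hTs j).invariant.sup ih
  -- If every translate were independent of the previous ones, the dimensions of the sums would
  -- exceed that of V.
  have hex : ∃ j, j ≤ Module.finrank K V ∧ T j ⊓ W j ≠ ⊥ := by
    by_contra! hcon
    have hrank : ∀ j ≤ Module.finrank K V + 1, j ≤ Module.finrank K (W j) := by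
      intro j hj
      induction j with
      | zero => simp
      | succ j ih =>
        have h1 := ih (by omega)
        have h2 := hcon j (by omega)
        have hlt : W j < W (j + 1) := by
          rw [hWsucc]
          refine lt_of_le_of_ne le_sup_right fun h => (hTs j).ne_bot ?_
          rw [← h2, eq_comm, inf_eq_left, h]
          exact le_sup_left
        have := Submodule.finrank_lt_finrank_of_lt hlt
        omega
    have h1 := hrank _ le_rfl
    have h2 := Submodule.finrank_le (W (Module.finrank K V + 1))
    omega
  classical
  obtain ⟨hjd, hj⟩ := Nat.find_spec hex
  set j := Nat.find hex with hjdef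
  have hjmin : ∀ i < j, T i ⊓ W i = ⊥ := by
    intro i hi
    have := Nat.find_min hex hi
    push Not at this
    exact this (by omega)
  -- The least l with T j ≤ W l is some i + 1. Then T i and T j both meet W i trivially and T j ≤ T
  -- i ⊔ W i, so T j embeds in T i modulo W i.
  have hex2 : ∃ l, T j ≤ W l := ⟨j, (hTs j).le_of_inf_ne_bot (hWi j) hj⟩
  have hlj : Nat.find hex2 ≤ j := Nat.find_min' hex2 ((hTs j).le_of_inf_ne_bot (hWi j) hj)
  have hl0 : Nat.find hex2 ≠ 0 := by
    intro h
    have := Nat.find_spec hex2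
    rw [h, hW0, le_bot_iff] at this
    exact (hTs j).ne_bot this
  obtain ⟨i, hi⟩ := Nat.exists_eq_succ_of_ne_zero hl0
  have hij : i < j := by omega
  have hTjW : T j ≤ T i ⊔ W i := by
    rw [← hWsucc, ← Nat.succ_eq_add_one, ← hi]
    exact Nat.find_spec hex2
  have hTj : T j ⊓ W i = ⊥ := by
    by_contra h
    exact Nat.find_min hex2 (show i < Nat.find hex2 by omega)
      ((hTs j).le_of_inf_ne_bot (hWi i) h)
  have hTi : T i ⊓ W i = ⊥ := hjmin i hij
  have hinj : ∀ l, T l ⊓ W i = ⊥ → ∀ u ∈ U, ρ (c ^ l) u ∈ W i → u = 0 := by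
    intro l hl u hu huW
    have h1 : ρ (c ^ l) u ∈ T l ⊓ W i := ⟨⟨u, hu, rfl⟩, huW⟩
    rw [hl, Submodule.mem_bot] at h1
    have h2 := representation_inv_apply ρ (c ^ l) u
    rw [h1, map_zero] at h2
    exact h2.symm
  have hexu : ∀ u : U, ∃ u' : U, ρ (c ^ j) u - ρ (c ^ i) u' ∈ W i := by
    intro u
    obtain ⟨_, ⟨u', hu', rfl⟩, w, hw, h⟩ := Submodule.mem_sup.1
      (hTjW (⟨u, u.2, rfl⟩ : ρ (c ^ j) u ∈ T j))
    exact ⟨⟨u', hu'⟩, by rw [← h]; simpa using hw⟩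
  choose f hf using hexu
  have huniq : ∀ u u' : U, ρ (c ^ j) u - ρ (c ^ i) u' ∈ W i → f u = u' := by
    intro u u' h
    have h1 : ρ (c ^ i) ((f u - u' : U) : V) ∈ W i := by
      have := (W i).sub_mem h (hf u)
      simpa using this
    have := hinj i hTi _ (f u - u').2 h1
    exact sub_eq_zero.1 (Subtype.ext this)
  refine ⟨i, j, hij, hjd, ⟨⟨f, fun u v => huniq _ _ ?_⟩, fun a u => huniq _ _ ?_⟩, ?_, ?_⟩
  · have := (W i).add_mem (hf u) (hf v)
    simp only [Submodule.coe_add, map_add]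
    convert this using 1
    abel
  · have := (W i).smul_mem a (hf u)
    simpa [smul_sub] using this
  · refine (injective_iff_map_eq_zero _).2 fun u hu => Subtype.ext (hinj j hTj u u.2 ?_)
    have hu : f u = 0 := hu
    simpa [hu] using hf u
  · intro g hg u u' hu'
    have hmem : ρ ((c ^ i)⁻¹ * g * c ^ i) (f u) ∈ U := by
      refine hU.invariant _ ?_ _ (f u).2
      simpa using (inferInstance : N.Normal).conj_mem g hg (c ^ i)⁻¹
    have h1 := huniq u' ⟨_, hmem⟩ (by
      have h2 := hWi i g hg _ (hf u)
      have e : ∀ l v, ρ (c ^ l) (ρ ((c ^ l)⁻¹ * g * c ^ l) v) = ρ g (ρ (c ^ l) v) := by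
        intro l v
        rw [representation_apply_apply, representation_apply_apply, mul_assoc,
          mul_inv_cancel_left]
      rwa [hu', e, e, ← map_sub])
    exact congrArg Subtype.val h1

/-- The representation of `N` on an invariant subspace. -/
def IsInvariantUnder.subrep (hU : IsInvariantUnder ρ N U) : N →* Module.End K U where
  toFun g := (ρ g).restrict (hU g g.2)
  map_one' := by ext; simp
  map_mul' g h := by ext; simp

theorem IsInvariantUnder.subrep_apply (hU : IsInvariantUnder ρ N U) (g : N) (u : U) :
    (hU.subrep g u : V) = ρ g u := rfl

/-- The determinant character of a simple subspace is invariant under conjugation by `c ^ k` if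
`k` is divisible by all positive integers up to `dim V`. -/
theorem IsSimpleUnder.det_conj_pow [FiniteDimensional K V] [hN : N.Normal]
    (hU : IsSimpleUnder ρ N U) (c : G) {k : ℕ}
    (hk : ∀ i, 1 ≤ i → i ≤ Module.finrank K V → i ∣ k) (g : N) :
    LinearMap.det (hU.invariant.subrep ⟨c ^ k * g * (c ^ k)⁻¹, hN.conj_mem g g.2 _⟩) =
      LinearMap.det (hU.invariant.subrep g) := by
  obtain ⟨i, j, hij, hj, F, hF, hFg⟩ := hU.exists_intertwiner c
  let e : U ≃ₗ[K] U := LinearEquiv.ofInjectiveEndo F hF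
  -- The intertwiner is an automorphism of U by finite dimension; apply it to c^j g c^(-j).
  have hstep : ∀ g : N, LinearMap.det (hU.invariant.subrep
      ⟨c ^ (j - i) * g * (c ^ (j - i))⁻¹, hN.conj_mem g g.2 _⟩) =
      LinearMap.det (hU.invariant.subrep g) := by
    intro g
    rw [← LinearMap.det_conj (hU.invariant.subrep g) e]
    congr 1
    ext u
    have h1 := hFg (c ^ j * g * (c ^ j)⁻¹) (hN.conj_mem g g.2 _) (e.symm u)
      (hU.invariant.subrep g (e.symm u)) (by
        rw [hU.invariant.subrep_apply]
        congr 2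
        group)
    have h2 : F (e.symm u) = u := e.apply_symm_apply u
    rw [h2] at h1
    rw [hU.invariant.subrep_apply]
    simp only [LinearMap.coe_comp, LinearEquiv.coe_coe, Function.comp_apply]
    refine Eq.trans ?_ h1.symm
    congr 2
    obtain ⟨m, rfl⟩ := Nat.exists_eq_add_of_lt hij
    have : i + m + 1 - i = m + 1 := by omega
    rw [this, add_assoc, pow_add]
    group
  have hiter : ∀ (q : ℕ) (g : N), LinearMap.det (hU.invariant.subrep
      ⟨c ^ ((j - i) * q) * g * (c ^ ((j - i) * q))⁻¹, hN.conj_mem g g.2 _⟩) =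
      LinearMap.det (hU.invariant.subrep g) := by
    intro q
    induction q with
    | zero => intro g; simp
    | succ q ih =>
      intro g
      rw [← ih g]
      refine Eq.trans ?_ (hstep ⟨_, hN.conj_mem g g.2 _⟩)
      congr 3
      simp only [mul_add, mul_one, add_comm _ (j - i), pow_add, mul_inv_rev, mul_assoc]
  -- The period j - i is not known, but it lies between 1 and dim V and so divides k.
  obtain ⟨q, rfl⟩ := hk (j - i) (by omega) (by omega)
  exact hiter q g

/-- For `y` commuting with `N`, a simple subspace has a copy in an eigenspace of `y`. -/
theorem IsSimpleUnder.exists_embedding_eigenspace [IsAlgClosed K] [FiniteDimensional K V]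
    (hU : IsSimpleUnder ρ N U) {y : G} (hy : ∀ g ∈ N, Commute g y) :
    ∃ (μ : K) (f : U →ₗ[K] V), Function.Injective f ∧ (∀ u, ρ y (f u) = μ • f u) ∧
      ∀ g : N, ∀ u : U, f (hU.invariant.subrep g u) = ρ g (f u) := by
  -- The N-equivariant maps U → V. As y commutes with N, it acts on them by composition, and an
  -- eigenvector of this action is the map sought.
  let M : Submodule K (U →ₗ[K] V) :=
    { carrier := {f | ∀ g : N, ∀ u : U, f (hU.invariant.subrep g u) = ρ g (f u)}
      add_mem' := fun {a b} ha hb g u => by simp [ha g u, hb g u]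
      zero_mem' := fun g u => by simp
      smul_mem' := fun a f hf g u => by simp [hf g u] }
  let E : Module.End K M :=
    { toFun := fun f => ⟨ρ y ∘ₗ f.1, fun g u => by
        have h1 := f.2 g u
        simp only [LinearMap.comp_apply, h1, ← Module.End.mul_apply, ← map_mul]
        rw [(hy g g.2).eq]⟩
      map_add' := fun f g => by ext; simp
      map_smul' := fun a f => by ext; simp }
  have : Nontrivial M := by
    refine ⟨⟨⟨U.subtype, fun g u => rfl⟩, 0, fun h => hU.ne_bot ?_⟩⟩
    have h1 : U.subtype = 0 := congrArg Subtype.val h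
    rw [← Submodule.range_subtype U, h1, LinearMap.range_zero]
  obtain ⟨μ, hμ⟩ := Module.End.exists_eigenvalue E
  obtain ⟨f, hf⟩ := hμ.exists_hasEigenvector
  refine ⟨μ, f.1, ?_, ?_, f.2⟩
  -- Schur's lemma: the kernel is N-invariant, so it is trivial or all of U.
  · rw [← LinearMap.ker_eq_bot]
    by_contra hker
    have h1 := hU.eq_of_le ((LinearMap.ker f.1).map U.subtype) (Submodule.map_subtype_le _ _)
      (fun h => hker (Submodule.map_injective_of_injective U.injective_subtype
        (h.trans (Submodule.map_bot _).symm))) (by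
        rintro g hg _ ⟨u, hu, rfl⟩
        refine ⟨hU.invariant.subrep ⟨g, hg⟩ u, ?_, rfl⟩
        have hu : f.1 u = 0 := hu
        change f.1 _ = 0
        rw [f.2, hu, map_zero])
    apply hf.2
    ext u
    obtain ⟨u', hu', h⟩ := h1.symm.le u.2
    have : u' = u := Subtype.ext h
    rw [← this]
    simpa using hu'
  · intro u
    have h1 := congrArg (fun F : M => F.1 u) (Module.End.mem_eigenspace_iff.1 hf.1)
    exact h1

end Representation

/-! ### Eigenvalue bounds for elements of the normal subgroup. -/

section Eigenvalues

/-- If T - μ were injective on every piece, it would be surjective on every piece by finite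
dimension, hence surjective and so injective on the whole space. -/
theorem exists_eigenvector_of_iSup_eq_top {K V ι : Type*} [Field K] [AddCommGroup V] [Module K V]
    [FiniteDimensional K V] {T : Module.End K V} {U : ι → Submodule K V}
    (hT : ∀ i, ∀ v ∈ U i, T v ∈ U i) (htop : ⨆ i, U i = ⊤) {μ : K} {v : V} (hv : v ≠ 0)
    (h : T v = μ • v) : ∃ i, ∃ u ∈ U i, u ≠ 0 ∧ T u = μ • u := by
  by_contra! hcon
  set A : Module.End K V := T - μ • LinearMap.id with hA
  have hAv : ∀ w, A w = T w - μ • w := fun w => rfl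
  have hAU : ∀ i, ∀ w ∈ U i, A w ∈ U i := fun i w hw =>
    (U i).sub_mem (hT i w hw) ((U i).smul_mem μ hw)
  have hrange : LinearMap.range A = ⊤ := by
    rw [eq_top_iff, ← htop, iSup_le_iff]
    intro i w hw
    have hinj : Function.Injective (A.restrict (hAU i)) := by
      refine (injective_iff_map_eq_zero _).2 fun u hu => ?_
      by_contra hu0
      refine hcon i u u.2 (fun h => hu0 (Subtype.ext h)) (sub_eq_zero.1 ?_)
      exact congrArg Subtype.val hu
    obtain ⟨u, hu⟩ := LinearMap.injective_iff_surjective.1 hinj ⟨w, hw⟩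
    exact ⟨u, congrArg Subtype.val hu⟩
  have hinj : Function.Injective A :=
    LinearMap.injective_iff_surjective.2 (LinearMap.range_eq_top.1 hrange)
  refine hv (hinj ?_)
  rw [hAv, h, sub_self, map_zero]

/-- If T - μ were injective it would be surjective, and so would be the map induced on the quotient,
which would then be injective too. -/
theorem exists_eigenvector_of_quotient {K V : Type*} [Field K] [AddCommGroup V] [Module K V]
    [FiniteDimensional K V] {T : Module.End K V} {W : Submodule K V} (hT : W ≤ W.comap T) {μ : K}
    {w : V ⧸ W} (hw : w ≠ 0) (h : W.mapQ W T hT w = μ • w) : ∃ v, v ≠ 0 ∧ T v = μ • v := by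
  by_contra! hcon
  have hinj : Function.Injective (T - μ • (LinearMap.id : Module.End K V)) := by
    refine (injective_iff_map_eq_zero _).2 fun u hu => ?_
    by_contra hu0
    exact hcon u hu0 (sub_eq_zero.1 (by simpa using hu))
  have hsurj : Function.Surjective
      (W.mapQ W T hT - μ • (LinearMap.id : Module.End K (V ⧸ W))) := by
    intro q
    obtain ⟨v, rfl⟩ := W.mkQ_surjective q
    obtain ⟨u, rfl⟩ := LinearMap.injective_iff_surjective.1 hinj v
    exact ⟨W.mkQ u, by simp⟩
  refine hw (LinearMap.injective_iff_surjective.2 hsurj ?_)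
  rw [map_zero, LinearMap.sub_apply, h]
  simp

theorem one_lt_multiset_prod_of_one_lt {s : Multiset ℝ} (hs : s ≠ 0) (h : ∀ a ∈ s, 1 < a) :
    1 < s.prod := by
  have key : ∀ t : Multiset ℝ, (∀ a ∈ t, 1 < a) → 1 ≤ t.prod := by
    intro t
    induction t using Multiset.induction_on with
    | empty => simp
    | cons a t ih =>
      intro h
      rw [Multiset.prod_cons]
      exact one_le_mul_of_one_le_of_one_le (h a (by simp)).le (ih fun b hb => h b (by simp [hb]))
  obtain ⟨a, ha⟩ := Multiset.exists_mem_of_ne_zero hs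
  obtain ⟨t, rfl⟩ := Multiset.exists_cons_of_mem ha
  rw [Multiset.prod_cons]
  exact one_lt_mul_of_lt_of_le (h a ha) (key t fun b hb => h b (by simp [hb]))

theorem multiset_prod_lt_one_of_lt_one {s : Multiset ℝ} (hs : s ≠ 0)
    (h : ∀ a ∈ s, 0 ≤ a ∧ a < 1) : s.prod < 1 := by
  have key : ∀ t : Multiset ℝ, (∀ a ∈ t, 0 ≤ a ∧ a < 1) → t.prod ≤ 1 := by
    intro t
    induction t using Multiset.induction_on with
    | empty => simp
    | cons a t ih =>
      intro h
      rw [Multiset.prod_cons]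
      exact mul_le_one₀ (h a (by simp)).2.le
        (Multiset.prod_nonneg fun b hb => (h b (by simp [hb])).1) (ih fun b hb => h b (by simp [hb]))
  obtain ⟨a, ha⟩ := Multiset.exists_mem_of_ne_zero hs
  obtain ⟨t, rfl⟩ := Multiset.exists_cons_of_mem ha
  rw [Multiset.prod_cons]
  exact (mul_le_of_le_one_right (h a ha).1 (key t fun b hb => h b (by simp [hb]))).trans_lt (h a ha).2

/-- The determinant is the product of the eigenvalues, so their norms cannot be all above 1 or all
below 1. -/
theorem exists_eigenvectors_of_det_eq_one {K U : Type*} [NormedField K] [IsAlgClosed K]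
    [AddCommGroup U] [Module K U] [FiniteDimensional K U] [Nontrivial U] {T : Module.End K U}
    (hT : LinearMap.det T = 1) :
    (∃ μ : K, ‖μ‖ ≤ 1 ∧ ∃ u, u ≠ 0 ∧ T u = μ • u) ∧
      ∃ μ : K, 1 ≤ ‖μ‖ ∧ ∃ u, u ≠ 0 ∧ T u = μ • u := by
  have hroot : ∀ μ ∈ T.charpoly.roots, ∃ u, u ≠ 0 ∧ T u = μ • u := by
    intro μ hμ
    have h1 := (Module.End.hasEigenvalue_iff_isRoot_charpoly T μ).2 (Polynomial.isRoot_of_mem_roots hμ)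
    obtain ⟨u, hu⟩ := h1.exists_hasEigenvector
    exact ⟨u, hu.2, Module.End.mem_eigenspace_iff.1 hu.1⟩
  have hsplit := IsAlgClosed.splits T.charpoly
  have hprod : T.charpoly.roots.prod = 1 := by
    rw [← hT, Module.End.det_eq_prod_roots_charpoly_of_splits hsplit]
  have hne : T.charpoly.roots ≠ 0 := by
    intro h
    have h1 := hsplit.natDegree_eq_card_roots
    rw [h, LinearMap.charpoly_natDegree, Multiset.card_zero] at h1
    exact (Module.finrank_pos (R := K) (M := U)).ne' h1
  have hnorm : (T.charpoly.roots.map fun μ => ‖μ‖).prod = 1 := by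
    have := map_multiset_prod (normHom : K →*₀ ℝ) T.charpoly.roots
    rw [hprod, map_one] at this
    exact this.symm
  constructor
  · by_contra! hcon
    refine (one_lt_multiset_prod_of_one_lt (by simpa using hne) ?_).ne' hnorm
    intro a ha
    obtain ⟨μ, hμ, rfl⟩ := Multiset.mem_map.1 ha
    by_contra! h
    obtain ⟨u, hu, hu'⟩ := hroot μ hμ
    exact hcon μ h u hu hu'
  · by_contra! hcon
    refine (multiset_prod_lt_one_of_lt_one (by simpa using hne) ?_).ne hnorm
    intro a ha
    obtain ⟨μ, hμ, rfl⟩ := Multiset.mem_map.1 ha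
    refine ⟨norm_nonneg _, ?_⟩
    by_contra! h
    obtain ⟨u, hu, hu'⟩ := hroot μ hμ
    exact hcon μ h u hu hu'

variable {K : Type*} [NormedField K] [IsAlgClosed K] {G : Type*} [Group G] {N : Subgroup G}

/-- On a copy of `U` where y acts as a scalar κ, an eigenvalue μ of x yields the eigenvalue κμ of
xy. Determinant one supplies some μ of norm at most 1 and some of norm at least 1, which confines
‖κ‖ to [R⁻¹, R]; removing κ costs the second factor R. -/
theorem IsSimpleUnder.norm_eigenvalue_bounds {V : Type*} [AddCommGroup V] [Module K V]
    [FiniteDimensional K V] {ρ : Representation K G V} {U : Submodule K V}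
    (hU : IsSimpleUnder ρ N U) {x : N} {y : G} (hy : ∀ g ∈ N, Commute g y)
    (hdet : LinearMap.det (hU.invariant.subrep x) = 1) {R : ℝ} (hR : 0 < R)
    (hxy : ∀ (μ : K) (v : V), v ≠ 0 → ρ (x * y) v = μ • v → R⁻¹ ≤ ‖μ‖ ∧ ‖μ‖ ≤ R)
    {μ : K} {u : V} (huU : u ∈ U) (hu : u ≠ 0) (h : ρ x u = μ • u) :
    (R ^ 2)⁻¹ ≤ ‖μ‖ ∧ ‖μ‖ ≤ R ^ 2 := by
  obtain ⟨κ, f, hf, hfy, hfx⟩ := hU.exists_embedding_eigenspace hy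
  have key : ∀ (μ : K) (u : U), u ≠ 0 → hU.invariant.subrep x u = μ • u →
      R⁻¹ ≤ ‖κ‖ * ‖μ‖ ∧ ‖κ‖ * ‖μ‖ ≤ R := by
    intro μ u hu h
    rw [← norm_mul]
    refine hxy _ (f u) ((map_ne_zero_iff f hf).2 hu) ?_
    rw [← representation_apply_apply, hfy, map_smul, ← hfx, h, map_smul, smul_smul]
  have : Nontrivial U := (Submodule.nontrivial_iff_ne_bot).2 hU.ne_bot
  obtain ⟨⟨μ₁, hμ₁, u₁, hu₁, h₁⟩, μ₂, hμ₂, u₂, hu₂, h₂⟩ := exists_eigenvectors_of_det_eq_one hdet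
  have k := key μ ⟨u, huU⟩ (fun h => hu (congrArg Subtype.val h)) (Subtype.ext h)
  have k₁ := key μ₁ u₁ hu₁ h₁
  have k₂ := key μ₂ u₂ hu₂ h₂
  have hκ1 : R⁻¹ ≤ ‖κ‖ := k₁.1.trans (mul_le_of_le_one_right (norm_nonneg _) hμ₁)
  have hκ2 : ‖κ‖ ≤ R := (le_mul_of_one_le_right (norm_nonneg _) hμ₂).trans k₂.2
  constructor
  · rw [pow_two, mul_inv, inv_mul_le_iff₀ hR]
    exact k.1.trans (by gcongr)
  · have h1 : R⁻¹ * ‖μ‖ ≤ R := (by gcongr : R⁻¹ * ‖μ‖ ≤ ‖κ‖ * ‖μ‖).trans k.2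
    rw [inv_mul_le_iff₀ hR] at h1
    linarith

/-- Let `N` be a normal subgroup of `G`, let `x = h c ^ k h⁻¹ c⁻ᵏ` with `h ∈ N` and let `y` commute
with `N`. In a representation of dimension at most `d`, the eigenvalues of `x` are controlled by
those of `x y`, provided that `k` is divisible by all positive integers up to `d`. -/
theorem norm_eigenvalue_bounds [hN : N.Normal] {h c x y : G} (hh : h ∈ N)
    (hy : ∀ g ∈ N, Commute g y) {d k : ℕ} (hk : ∀ i, 1 ≤ i → i ≤ d → i ∣ k)
    (hx : x = h * c ^ k * h⁻¹ * (c ^ k)⁻¹) {R : ℝ} (hR : 0 < R)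
    {V : Type*} [AddCommGroup V] [Module K V] [FiniteDimensional K V] (hV : Module.finrank K V ≤ d)
    (ρ : Representation K G V)
    (hxy : ∀ (μ : K) (v : V), v ≠ 0 → ρ (x * y) v = μ • v → R⁻¹ ≤ ‖μ‖ ∧ ‖μ‖ ≤ R)
    {μ : K} {v : V} (hv : v ≠ 0) (hμ : ρ x v = μ • v) :
    (R ^ 2)⁻¹ ≤ ‖μ‖ ∧ ‖μ‖ ≤ R ^ 2 := by
  induction hn : Module.finrank K V using Nat.strong_induction_on generalizing V with
  | _ n ih =>
    subst hn
    -- Reduction to irreducible V: the eigenvector lies in a proper invariant W or survives in V/W,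
    -- and eigenvalues of xy on either are eigenvalues on V.
    by_cases hred : ∃ W : Submodule K V, W ≠ ⊥ ∧ W ≠ ⊤ ∧ ∀ g, W ≤ W.comap (ρ g)
    · obtain ⟨W, hW0, hWtop, hW⟩ := hred
      by_cases hvW : v ∈ W
      · have hlt : Module.finrank K W < Module.finrank K V :=
          Submodule.finrank_lt hWtop
        refine ih _ hlt (hlt.le.trans hV) (ρ.subrepresentation W hW) ?_
          (v := ⟨v, hvW⟩) (fun h => hv (congrArg Subtype.val h)) (Subtype.ext hμ) rfl
        intro ν w hw hνw
        exact hxy ν w (fun h => hw (Subtype.ext h)) (congrArg Subtype.val hνw)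
      · have hlt : Module.finrank K (V ⧸ W) < Module.finrank K V := by
          have h1 := W.finrank_quotient_add_finrank
          have h2 : Module.finrank K W ≠ 0 := fun h => hW0 (Submodule.finrank_eq_zero.1 h)
          omega
        refine ih _ hlt (hlt.le.trans hV) (ρ.quotient W hW) ?_
          (v := W.mkQ v) (fun h => hvW ((Submodule.Quotient.mk_eq_zero W).1 h)) ?_ rfl
        · intro ν w hw hνw
          obtain ⟨v', hv', h'⟩ := exists_eigenvector_of_quotient (hW (x * y)) hw hνw
          exact hxy ν v' hv' h'
        · rw [← map_smul, ← hμ]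
          rfl
    · push Not at hred
      have htop0 : (⊤ : Submodule K V) ≠ ⊥ := fun h =>
        hv ((Submodule.mem_bot K).1 (h ▸ Submodule.mem_top))
      obtain ⟨U, -, hU⟩ := exists_isSimpleUnder (ρ := ρ) (N := N) htop0 fun _ _ _ _ => trivial
      -- Clifford: the translates of an N-simple subspace span an irreducible V.
      have htop : ⨆ g : G, U.map (ρ g) = ⊤ := by
        by_contra hne
        obtain ⟨g, hg⟩ := hred (⨆ g : G, U.map (ρ g))
          (fun h => hU.ne_bot (by
            have h1 := le_iSup (fun g : G => U.map (ρ g)) 1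
            rw [h, le_bot_iff] at h1
            by_contra h0
            exact map_representation_ne_bot h0 1 h1)) hne
        apply hg
        rw [← Submodule.map_le_iff_le_comap, Submodule.map_iSup]
        refine iSup_le fun g' => ?_
        rw [← Submodule.map_comp, ← Module.End.mul_eq_comp, ← map_mul]
        exact le_iSup (fun g : G => U.map (ρ g)) (g * g')
      have hxN : x ∈ N := by
        rw [hx, mul_assoc h, mul_assoc h]
        exact N.mul_mem hh (hN.conj_mem _ (N.inv_mem hh) _)
      obtain ⟨g, u, huU, hu, hμu⟩ := exists_eigenvector_of_iSup_eq_top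
        (U := fun g : G => U.map (ρ g)) (fun g => (hU.map g).invariant x hxN) htop hv hμ
      have hUg := hU.map g
      refine hUg.norm_eigenvalue_bounds (x := ⟨x, hxN⟩) hy ?_ hR hxy huU hu hμu
      -- Factoring x inside N as h times a conjugate of h⁻¹ makes its determinant on the translate
      -- equal to 1.
      have hx' : (⟨x, hxN⟩ : N) = ⟨h, hh⟩ * ⟨c ^ k * (⟨h, hh⟩⁻¹ : N) * (c ^ k)⁻¹,
          hN.conj_mem _ (Subtype.prop _) _⟩ := by
        ext
        simp [hx, mul_assoc]
      rw [hx', map_mul, map_mul, hUg.det_conj_pow c (fun i h1 h2 => hk i h1 (h2.trans hV)),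
        ← map_mul, ← map_mul, mul_inv_cancel, map_one, map_one]

end Eigenvalues


/-! ### A subadditive logarithmic size of operators. -/

section LogNorm

variable {G A : Type*} [Group G] [NormedRing A]

/-- The logarithm of the larger of the norms of `ρ g` and of its inverse, made nonnegative. -/
noncomputable def logNorm (ρ : G →* Aˣ) (g : G) : ℝ :=
  Real.log (max 1 (max ‖(ρ g : A)‖ ‖(ρ g⁻¹ : A)‖))

variable (ρ : G →* Aˣ)

theorem logNorm_nonneg (g : G) : 0 ≤ logNorm ρ g := Real.log_nonneg (le_max_left _ _)

theorem logNorm_inv (g : G) : logNorm ρ g⁻¹ = logNorm ρ g := by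
  rw [logNorm, logNorm, inv_inv, max_comm ‖(ρ g⁻¹ : A)‖]

theorem exp_logNorm (g : G) :
    Real.exp (logNorm ρ g) = max 1 (max ‖(ρ g : A)‖ ‖(ρ g⁻¹ : A)‖) :=
  Real.exp_log (lt_max_of_lt_left one_pos)

theorem norm_le_exp_logNorm (g : G) : ‖(ρ g : A)‖ ≤ Real.exp (logNorm ρ g) := by
  rw [exp_logNorm]
  exact (le_max_left _ _).trans (le_max_right _ _)

theorem logNorm_mul_le (g h : G) : logNorm ρ (g * h) ≤ logNorm ρ g + logNorm ρ h := by
  rw [← Real.exp_le_exp, Real.exp_add, exp_logNorm ρ (g * h)]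
  refine max_le ?_ (max_le ?_ ?_)
  · exact one_le_mul_of_one_le_of_one_le (Real.one_le_exp (logNorm_nonneg ρ g))
      (Real.one_le_exp (logNorm_nonneg ρ h))
  · rw [map_mul, Units.val_mul]
    exact (norm_mul_le _ _).trans (mul_le_mul (norm_le_exp_logNorm ρ g) (norm_le_exp_logNorm ρ h)
      (norm_nonneg _) (Real.exp_nonneg _))
  · rw [mul_inv_rev, map_mul, Units.val_mul, mul_comm (Real.exp _), ← logNorm_inv ρ g,
      ← logNorm_inv ρ h]
    exact (norm_mul_le _ _).trans (mul_le_mul (norm_le_exp_logNorm ρ _) (norm_le_exp_logNorm ρ _)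
      (norm_nonneg _) (Real.exp_nonneg _))

/-- The summand `logNorm ρ 1` covers n = 0, since ‖1‖ may exceed 1 in a normed ring. -/
theorem logNorm_pow_le (n : ℕ) (g : G) : logNorm ρ (g ^ n) ≤ logNorm ρ 1 + n * logNorm ρ g := by
  induction n with
  | zero => simp
  | succ n ih =>
    rw [pow_succ]
    have := logNorm_mul_le ρ (g ^ n) g
    push_cast
    linarith

end LogNorm

/-! ### Norms of matrix powers in terms of eigenvalues. -/

section MatrixPowers

open scoped Matrix.Norms.Operator

/-- With Z = (a - μ)X, which the shorter product kills, a^(n+1) X = a^n Z + μ a^n X. Each root thus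
contributes Q once, while the exponent n falls on R only. -/
theorem norm_pow_mul_le_of_prod_sub_mul_eq_zero {K A : Type*} [NormedField K] [NormedRing A]
    [NormedAlgebra K A] {a : A} {Q R : ℝ} (hQ : ‖a‖ ≤ Q) (hR : 1 ≤ R) (hRQ : R ≤ Q) (l : List K)
    (hl : ∀ μ ∈ l, ‖μ‖ ≤ R) (X : A)
    (hX : (l.map fun μ => a - algebraMap K A μ).prod * X = 0) (n : ℕ) :
    ‖a ^ n * X‖ ≤ (2 * Q) ^ l.length * (2 * R) ^ n * ‖X‖ := by
  induction l using List.reverseRecOn generalizing X n with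
  | nil => simp_all
  | append_singleton l μ ih =>
    have hμ : ‖μ‖ ≤ R := hl μ (by simp)
    set Z := (a - algebraMap K A μ) * X with hZ
    have hZ' : Z = a * X - μ • X := by rw [hZ, sub_mul, Algebra.smul_def]
    have h1 := ih (fun ν hν => hl ν (by simp [hν])) Z (by
      rw [hZ, ← mul_assoc]
      simpa using hX)
    have hZn : ‖Z‖ ≤ 2 * Q * ‖X‖ := by
      have h2 : ‖a * X‖ ≤ Q * ‖X‖ := (norm_mul_le _ _).trans (by gcongr)
      have h3 : ‖μ • X‖ ≤ Q * ‖X‖ := by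
        rw [norm_smul]
        gcongr
        exact hμ.trans hRQ
      rw [hZ']
      refine (norm_sub_le _ _).trans ?_
      linarith
    induction n with
    | zero =>
      simp only [pow_zero, one_mul, mul_one]
      exact le_mul_of_one_le_left (norm_nonneg _) (one_le_pow₀ (by linarith))
    | succ n ihn =>
      have e : a ^ (n + 1) * X = a ^ n * Z + μ • (a ^ n * X) := by
        rw [hZ', mul_sub, mul_smul_comm, sub_add_cancel, pow_succ, mul_assoc]
      have h3 : ‖μ • (a ^ n * X)‖ ≤
          R * ((2 * Q) ^ (l ++ [μ]).length * (2 * R) ^ n * ‖X‖) := by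
        rw [norm_smul]
        exact mul_le_mul hμ ihn (norm_nonneg _) (by linarith)
      have h4 : ‖a ^ n * Z‖ ≤ R * ((2 * Q) ^ (l ++ [μ]).length * (2 * R) ^ n * ‖X‖) := by
        refine (h1 n).trans ?_
        calc (2 * Q) ^ l.length * (2 * R) ^ n * ‖Z‖
            ≤ (2 * Q) ^ l.length * (2 * R) ^ n * (2 * Q * ‖X‖) := by
              have : 0 ≤ Q := by linarith
              gcongr
          _ = 1 * ((2 * Q) ^ (l ++ [μ]).length * (2 * R) ^ n * ‖X‖) := by
              simp only [List.length_append, List.length_singleton, pow_succ]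
              ring
          _ ≤ _ := by
              have : 0 ≤ Q := by linarith
              gcongr
      rw [e]
      refine (norm_add_le _ _).trans ((add_le_add h4 h3).trans (le_of_eq ?_))
      ring

variable {K : Type*} [NormedField K] {d : ℕ}

theorem norm_entry_le (A : Matrix (Fin d) (Fin d) K) (i j : Fin d) : ‖A i j‖ ≤ ‖A‖ := by
  have h1 := Matrix.linfty_opNorm_mulVec A (Pi.single j 1)
  have h2 : ‖(Pi.single j 1 : Fin d → K)‖ = 1 := by rw [Pi.norm_single, norm_one]
  rw [h2, mul_one] at h1
  refine le_trans ?_ ((norm_le_pi_norm _ i).trans h1)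
  simp

theorem norm_le_of_mulVec_eq_smul {A : Matrix (Fin d) (Fin d) K} {μ : K} {v : Fin d → K}
    (hv : v ≠ 0) (h : A.mulVec v = μ • v) : ‖μ‖ ≤ ‖A‖ := by
  have h1 := Matrix.linfty_opNorm_mulVec A v
  rw [h, norm_smul] at h1
  exact le_of_mul_le_mul_right h1 (norm_pos_iff.2 hv)

/-- Cayley–Hamilton supplies the annihilating product, with d roots and X = 1. -/
theorem norm_pow_le_of_eigenvalues [IsAlgClosed K] {A : Matrix (Fin d) (Fin d) K} {Q R : ℝ}
    (hQ : ‖A‖ ≤ Q) (hR : 1 ≤ R) (hRQ : R ≤ Q)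
    (hA : ∀ (μ : K) (v : Fin d → K), v ≠ 0 → A.mulVec v = μ • v → ‖μ‖ ≤ R) (n : ℕ) :
    ‖A ^ n‖ ≤ (2 * Q) ^ d * (2 * R) ^ n * ‖(1 : Matrix (Fin d) (Fin d) K)‖ := by
  have hsplit := IsAlgClosed.splits A.charpoly
  have hlen : A.charpoly.roots.toList.length = d := by
    rw [Multiset.length_toList, ← hsplit.natDegree_eq_card_roots, Matrix.charpoly_natDegree_eq_dim,
      Fintype.card_fin]
  have h1 := norm_pow_mul_le_of_prod_sub_mul_eq_zero hQ hR hRQ A.charpoly.roots.toList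
    (fun μ hμ => by
      have h2 := Polynomial.isRoot_of_mem_roots (Multiset.mem_toList.1 hμ)
      rw [← Matrix.charpoly_toLin', ← Module.End.hasEigenvalue_iff_isRoot_charpoly] at h2
      obtain ⟨v, hv⟩ := h2.exists_hasEigenvector
      exact hA μ v hv.2 (by simpa using Module.End.mem_eigenspace_iff.1 hv.1)) 1 (by
      have h3 := Matrix.aeval_self_charpoly A
      rw [hsplit.eq_prod_roots_of_monic A.charpoly_monic, ← Multiset.coe_toList A.charpoly.roots,
        Multiset.map_coe, Multiset.prod_coe, map_list_prod, List.map_map] at h3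
      rw [mul_one, ← h3]
      congr 2
      ext1 μ
      simp) n
  rwa [mul_one, hlen] at h1

end MatrixPowers

/-! ### The fibre product and the growth of the powers of `twoSquares`. -/

section FibreProduct

variable {Γ Q : Type*} [Group Γ]

/-- The diagonal embedding of `Γ` into the fibre product. -/
def fibreDiag [Group Q] (φ : Γ →* Q) : Γ →* fibreProduct φ :=
  ((MonoidHom.id Γ).prod (MonoidHom.id Γ)).codRestrict (fibreProduct φ) fun _ => rfl

/-- The embedding of the kernel as the first factor of the fibre product. -/
def fibreInl [Group Q] (φ : Γ →* Q) : φ.ker →* fibreProduct φ :=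
  ((MonoidHom.inl Γ Γ).comp φ.ker.subtype).codRestrict (fibreProduct φ) fun g =>
    (g.2.trans (map_one φ).symm : φ g = φ 1)

@[simp]
theorem coe_fibreDiag [Group Q] (φ : Γ →* Q) (g : Γ) : (fibreDiag φ g : Γ × Γ) = (g, g) := rfl

@[simp]
theorem coe_fibreInl [Group Q] (φ : Γ →* Q) (g : φ.ker) : (fibreInl φ g : Γ × Γ) = ((g : Γ), 1) :=
  rfl

/-- (g₁, g₂) = (g₁g₂⁻¹, 1)(g₂, g₂), so the kernel in the first factor and the diagonal generate. -/
theorem fibreProduct_fg [Group Q] (φ : Γ →* Q) [Group.FG Γ] (hker : φ.ker.FG) :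
    Group.FG (fibreProduct φ) := by
  have : Group.FG φ.ker := (Group.fg_iff_subgroup_fg _).2 hker
  have h1 : (fibreDiag φ).range.FG := (Group.fg_iff_subgroup_fg _).1 inferInstance
  have h2 : (fibreInl φ).range.FG := (Group.fg_iff_subgroup_fg _).1 inferInstance
  have h3 : (fibreInl φ).range ⊔ (fibreDiag φ).range = ⊤ := by
    rw [eq_top_iff]
    intro p _
    have hp : φ p.1.1 = φ p.1.2 := p.2
    have hk : p.1.1 * p.1.2⁻¹ ∈ φ.ker := by
      rw [MonoidHom.mem_ker, map_mul, map_inv, hp, mul_inv_cancel]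
    have e : p = fibreInl φ ⟨_, hk⟩ * fibreDiag φ p.1.2 := by
      apply Subtype.ext
      ext <;> simp
    rw [e]
    exact Subgroup.mul_mem_sup ⟨_, rfl⟩ ⟨_, rfl⟩
  rw [Group.fg_def, ← h3]
  exact h2.sup h1

variable [CommGroup Q] (φ : Γ →* Q)

/-- The commutator of `a ^ i` and `b ^ j`, as an element of the kernel of a homomorphism to an
abelian group. -/
def rectangle (a b : Γ) (i j : ℕ) : φ.ker :=
  ⟨a ^ i * b ^ j * (a ^ i)⁻¹ * (b ^ j)⁻¹, by
    rw [MonoidHom.mem_ker]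
    simp only [map_mul, map_inv]
    rw [mul_comm (φ (a ^ i)) (φ (b ^ j)), mul_inv_cancel_right, mul_inv_cancel]⟩

/-- Two squares of side `n` traversed in opposite directions, at distance proportional to `n`. -/
def twoSquares (a b : Γ) (D n : ℕ) : fibreProduct φ :=
  fibreInl φ (rectangle φ a b n n) * fibreDiag φ a⁻¹ ^ (D * n) *
    (fibreInl φ (rectangle φ a b n n))⁻¹ * (fibreDiag φ a⁻¹ ^ (D * n))⁻¹

section

variable {A : Type*} [NormedRing A] (ρ : fibreProduct φ →* Aˣ)

theorem fibreInl_rectangle_succ_left (a b : Γ) (i j : ℕ) :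
    fibreInl φ (rectangle φ a b (i + 1) j) =
      fibreDiag φ a * fibreInl φ (rectangle φ a b i j) * (fibreDiag φ a)⁻¹ *
        fibreInl φ (rectangle φ a b 1 j) := by
  apply Subtype.ext
  ext
  · simp [rectangle, pow_succ', mul_assoc]
  · simp

theorem fibreInl_rectangle_succ_right (a b : Γ) (j : ℕ) :
    fibreInl φ (rectangle φ a b 1 (j + 1)) =
      fibreInl φ (rectangle φ a b 1 1) * (fibreDiag φ b * fibreInl φ (rectangle φ a b 1 j) *
        (fibreDiag φ b)⁻¹) := by
  apply Subtype.ext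
  ext
  · simp [rectangle, pow_succ', mul_assoc]
  · simp

/-- The square is tiled by n² unit commutators, and passing from one tile or row to the next is
conjugation by a single diagonal letter. -/
theorem exists_logNorm_rectangle_le (a b : Γ) :
    ∃ C : ℝ, 0 ≤ C ∧ ∀ n : ℕ, 1 ≤ n →
      logNorm ρ (fibreInl φ (rectangle φ a b n n)) ≤ C * (n : ℝ) ^ 2 := by
  set α := logNorm ρ (fibreDiag φ a) with hα
  set β := logNorm ρ (fibreDiag φ b) with hβ
  set e := logNorm ρ 1 with he
  set σ := logNorm ρ (fibreInl φ (rectangle φ a b 1 1)) with hσ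
  have hα0 : 0 ≤ α := logNorm_nonneg _ _
  have hβ0 : 0 ≤ β := logNorm_nonneg _ _
  have he0 : 0 ≤ e := logNorm_nonneg _ _
  have hσ0 : 0 ≤ σ := logNorm_nonneg _ _
  have hzero : ∀ i j, i = 0 ∨ j = 0 → fibreInl φ (rectangle φ a b i j) = 1 := by
    rintro i j (rfl | rfl) <;> (apply Subtype.ext; simp [rectangle])
  have h1 : ∀ j : ℕ, logNorm ρ (fibreInl φ (rectangle φ a b 1 j)) ≤ e + j * (σ + 2 * β) := by
    intro j
    induction j with
    | zero => simp [hzero 1 0 (Or.inr rfl), he]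
    | succ j ih =>
      rw [fibreInl_rectangle_succ_right]
      have k1 := logNorm_mul_le ρ (fibreInl φ (rectangle φ a b 1 1))
        (fibreDiag φ b * fibreInl φ (rectangle φ a b 1 j) * (fibreDiag φ b)⁻¹)
      have k2 := logNorm_mul_le ρ (fibreDiag φ b * fibreInl φ (rectangle φ a b 1 j))
        (fibreDiag φ b)⁻¹
      have k3 := logNorm_mul_le ρ (fibreDiag φ b) (fibreInl φ (rectangle φ a b 1 j))
      rw [logNorm_inv] at k2
      push_cast
      linarith
  have h2 : ∀ i j : ℕ, logNorm ρ (fibreInl φ (rectangle φ a b i j)) ≤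
      e + i * (2 * α + (e + j * (σ + 2 * β))) := by
    intro i j
    induction i with
    | zero => simp [hzero 0 j (Or.inl rfl), he]
    | succ i ih =>
      rw [fibreInl_rectangle_succ_left]
      have k1 := logNorm_mul_le ρ
        (fibreDiag φ a * fibreInl φ (rectangle φ a b i j) * (fibreDiag φ a)⁻¹)
        (fibreInl φ (rectangle φ a b 1 j))
      have k2 := logNorm_mul_le ρ (fibreDiag φ a * fibreInl φ (rectangle φ a b i j))
        (fibreDiag φ a)⁻¹
      have k3 := logNorm_mul_le ρ (fibreDiag φ a) (fibreInl φ (rectangle φ a b i j))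
      have k4 := h1 j
      rw [logNorm_inv] at k2
      push_cast
      linarith
  refine ⟨2 * e + 2 * α + σ + 2 * β, by positivity, fun n hn => (h2 n n).trans ?_⟩
  have hn' : (1 : ℝ) ≤ n := by exact_mod_cast hn
  have hn2 : (n : ℝ) ≤ n ^ 2 := by nlinarith
  have hn3 : (1 : ℝ) ≤ n ^ 2 := by nlinarith
  nlinarith [mul_nonneg he0 (sub_nonneg.2 hn3), mul_nonneg he0 (sub_nonneg.2 hn2),
    mul_nonneg hα0 (sub_nonneg.2 hn2)]

theorem logNorm_commutator_le (x y : fibreProduct φ) :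
    logNorm ρ (x * y * x⁻¹ * y⁻¹) ≤ 2 * logNorm ρ x + 2 * logNorm ρ y := by
  have k1 := logNorm_mul_le ρ (x * y * x⁻¹) y⁻¹
  have k2 := logNorm_mul_le ρ (x * y) x⁻¹
  have k3 := logNorm_mul_le ρ x y
  rw [logNorm_inv] at k1 k2
  linarith

theorem exists_logNorm_pow_le (a : fibreProduct φ) (D : ℕ) :
    ∃ C : ℝ, 0 ≤ C ∧ ∀ n : ℕ, 1 ≤ n → logNorm ρ (a ^ (D * n)) ≤ C * n := by
  have h1 := logNorm_nonneg ρ a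
  have h2 := logNorm_nonneg ρ 1
  refine ⟨logNorm ρ 1 + D * logNorm ρ a, by positivity, fun n hn => ?_⟩
  have hn' : (1 : ℝ) ≤ n := by exact_mod_cast hn
  refine (logNorm_pow_le ρ _ _).trans ?_
  push_cast
  nlinarith

end

section

open scoped Matrix.Norms.Operator

variable {K : Type*} [NormedField K] [IsAlgClosed K] {d : ℕ}

omit [IsAlgClosed K] in
theorem inv_mulVec_eq_smul {g : GL (Fin d) K} {μ : K} {v : Fin d → K} (hv : v ≠ 0)
    (h : (g : Matrix (Fin d) (Fin d) K).mulVec v = μ • v) :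
    μ ≠ 0 ∧ ((g⁻¹ : GL (Fin d) K) : Matrix (Fin d) (Fin d) K).mulVec v = μ⁻¹ • v := by
  have h1 : ((g⁻¹ : GL (Fin d) K) : Matrix (Fin d) (Fin d) K).mulVec (μ • v) = v := by
    rw [← h, Matrix.mulVec_mulVec, ← Units.val_mul, inv_mul_cancel, Units.val_one,
      Matrix.one_mulVec]
  have hμ : μ ≠ 0 := by
    rintro rfl
    rw [zero_smul, Matrix.mulVec_zero] at h1
    exact hv h1.symm
  refine ⟨hμ, ?_⟩
  rw [Matrix.mulVec_smul] at h1
  rw [eq_inv_smul_iff₀ hμ, h1]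

/-- Here N is the kernel of the second projection, x = (u, 1) and y = (1, u), so xy is the diagonal
element whose size is controlled by R. -/
theorem mulVec_eigenvalue_bounds {φ} {a b : Γ} {D n : ℕ} (hD : ∀ i, 1 ≤ i → i ≤ d → i ∣ D)
    (ρ : fibreProduct φ →* GL (Fin d) K) {μ : K} {v : Fin d → K} (hv : v ≠ 0)
    (h : (ρ (twoSquares (Q := Q) φ a b D n) : Matrix (Fin d) (Fin d) K).mulVec v = μ • v) {R : ℝ}
    (hR : logNorm ρ (fibreDiag φ (twoSquares φ a b D n).1.1) ≤ R) :
    ‖μ‖ ≤ Real.exp (2 * R) ∧ ‖μ⁻¹‖ ≤ Real.exp (2 * R) := by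
  let τ : Representation K (fibreProduct φ) (Fin d → K) :=
    (Matrix.toLinAlgEquiv' : Matrix (Fin d) (Fin d) K ≃ₐ[K] _).toMonoidHom.comp
      ((Units.coeHom _).comp ρ)
  have hτ : ∀ p v, τ p v = (ρ p : Matrix (Fin d) (Fin d) K).mulVec v := fun p v => rfl
  let N : Subgroup (fibreProduct φ) :=
    ((MonoidHom.snd Γ Γ).comp (fibreProduct φ).subtype).ker
  have hN : ∀ g : fibreProduct φ, g ∈ N ↔ g.1.2 = 1 := fun g => Iff.rfl
  set u := (twoSquares φ a b D n).1.1 with hu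
  have hu2 : (twoSquares φ a b D n).1.2 = 1 := by simp [twoSquares]
  have huφ : φ u = 1 := by
    have : φ (twoSquares φ a b D n).1.1 = φ (twoSquares φ a b D n).1.2 := (twoSquares φ a b D n).2
    rw [hu, this, hu2, map_one]
  let y : fibreProduct φ := ⟨(1, u), ((map_one φ).trans huφ.symm : φ 1 = φ u)⟩
  have hxy : twoSquares φ a b D n * y = fibreDiag φ u := by
    apply Subtype.ext
    ext
    · simp [y, hu]
    · simp [y, hu2]
  have key := norm_eigenvalue_bounds (K := K) (N := N) (h := fibreInl φ (rectangle φ a b n n))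
    (c := fibreDiag φ a⁻¹) (x := twoSquares φ a b D n) (y := y) (d := d) (k := D * n)
    ((hN _).2 rfl)
    (fun g hg => by
      have hg2 := (hN g).1 hg
      apply Subtype.ext
      ext <;> simp [y, hg2])
    (fun i h1 h2 => (hD i h1 h2).mul_right n) rfl (Real.exp_pos R) (by simp) τ
    (fun ν w hw hνw => by
      rw [hxy, hτ] at hνw
      have h1 : ‖ν‖ ≤ Real.exp R :=
        (norm_le_of_mulVec_eq_smul hw hνw).trans
          ((norm_le_exp_logNorm ρ _).trans (Real.exp_le_exp.2 hR))
      obtain ⟨hν, hinv⟩ := inv_mulVec_eq_smul hw hνw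
      rw [← map_inv] at hinv
      have h3 : ‖ν⁻¹‖ ≤ Real.exp R :=
        (norm_le_of_mulVec_eq_smul hw hinv).trans
          ((norm_le_exp_logNorm ρ _).trans (Real.exp_le_exp.2 (by rwa [logNorm_inv])))
      refine ⟨?_, h1⟩
      rw [norm_inv] at h3
      exact inv_le_of_inv_le₀ (norm_pos_iff.2 hν) h3)
    hv h
  rw [← Real.exp_nat_mul] at key
  push_cast at key
  refine ⟨key.2, ?_⟩
  rw [norm_inv]
  exact inv_le_of_inv_le₀ (Real.exp_pos _) key.1

/-- The growth of `twoSquares φ a b D n ^ n` in linear representations of dimension at most `d`,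
where `D` is divisible by all positive integers up to `d`. -/
theorem exists_norm_entry_twoSquares_pow_le {D : ℕ} (hD : ∀ i, 1 ≤ i → i ≤ d → i ∣ D) (a b : Γ)
    (ρ : fibreProduct φ →* GL (Fin d) K) :
    ∃ C : ℝ, 0 ≤ C ∧ ∀ n : ℕ, 1 ≤ n → ∀ i j,
      ‖(ρ (twoSquares φ a b D n ^ n) : Matrix (Fin d) (Fin d) K) i j‖ ≤
        Real.exp (C * (n : ℝ) ^ 2) ∧
      ‖(ρ (twoSquares φ a b D n ^ n)⁻¹ : Matrix (Fin d) (Fin d) K) i j‖ ≤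
        Real.exp (C * (n : ℝ) ^ 2) := by
  obtain ⟨C₁, hC₁0, hC₁⟩ := exists_logNorm_rectangle_le φ ρ a b
  obtain ⟨C₂, hC₂0, hC₂⟩ := exists_logNorm_pow_le φ ρ (fibreDiag φ a⁻¹) D
  obtain ⟨C₃, hC₃0, hC₃⟩ := exists_logNorm_pow_le φ ρ (fibreDiag φ a) 1
  obtain ⟨C₄, hC₄0, hC₄⟩ := exists_logNorm_pow_le φ ρ (fibreDiag φ b) 1
  -- E n bounds the diagonal element of u, written as a nested commutator of powers of diagonal
  -- letters; F n² bounds x itself. The summand 2E in F ensures that the eigenvalue bound stays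
  -- below the norm bound.
  set E := 2 * (2 * C₃ + 2 * C₄) + 2 * C₂ with hE
  set F := 2 * C₁ + 2 * C₂ + 2 * E with hF
  have hE0 : 0 ≤ E := by positivity
  have hF0 : 0 ≤ F := by positivity
  have hone : ∃ c : ℝ, 0 ≤ c ∧ ‖(1 : Matrix (Fin d) (Fin d) K)‖ ≤ Real.exp c :=
    ⟨‖(1 : Matrix (Fin d) (Fin d) K)‖, norm_nonneg _, by
      linarith [Real.add_one_le_exp ‖(1 : Matrix (Fin d) (Fin d) K)‖]⟩
  obtain ⟨c, hc0, hc⟩ := hone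
  refine ⟨d * (1 + F) + (1 + 2 * E) + c, by positivity, fun n hn => ?_⟩
  have hn' : (1 : ℝ) ≤ n := by exact_mod_cast hn
  have hn2 : (n : ℝ) ≤ n ^ 2 := by nlinarith
  have hn3 : (1 : ℝ) ≤ n ^ 2 := by nlinarith
  set x := twoSquares φ a b D n with hx
  have hxQ : logNorm ρ x ≤ F * (n : ℝ) ^ 2 := by
    have h1 := logNorm_commutator_le φ ρ (fibreInl φ (rectangle φ a b n n))
      (fibreDiag φ a⁻¹ ^ (D * n))
    have h2 := hC₁ n hn
    have h3 := hC₂ n hn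
    refine h1.trans ?_
    rw [hF]
    nlinarith [mul_nonneg hC₂0 (sub_nonneg.2 hn2), mul_nonneg hE0 (sub_nonneg.2 hn3)]
  have hxR : logNorm ρ (fibreDiag φ x.1.1) ≤ E * n := by
    have e : fibreDiag φ x.1.1 =
        (fibreDiag φ a ^ (1 * n) * fibreDiag φ b ^ (1 * n) * (fibreDiag φ a ^ (1 * n))⁻¹ *
          (fibreDiag φ b ^ (1 * n))⁻¹) * fibreDiag φ a⁻¹ ^ (D * n) *
        (fibreDiag φ a ^ (1 * n) * fibreDiag φ b ^ (1 * n) * (fibreDiag φ a ^ (1 * n))⁻¹ *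
          (fibreDiag φ b ^ (1 * n))⁻¹)⁻¹ * (fibreDiag φ a⁻¹ ^ (D * n))⁻¹ := by
      simp only [one_mul, ← map_pow, ← map_mul, ← map_inv]
      rfl
    rw [e]
    refine (logNorm_commutator_le φ ρ _ _).trans ?_
    have h1 := logNorm_commutator_le φ ρ (fibreDiag φ a ^ (1 * n)) (fibreDiag φ b ^ (1 * n))
    have h2 := hC₂ n hn
    have h3 := hC₃ n hn
    have h4 := hC₄ n hn
    rw [hE]
    linarith
  have hRQ : Real.exp (2 * (E * n)) ≤ Real.exp (F * (n : ℝ) ^ 2) := by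
    rw [Real.exp_le_exp, hF]
    nlinarith [mul_nonneg hE0 (sub_nonneg.2 hn2), mul_nonneg hC₁0 (sq_nonneg (n : ℝ)),
      mul_nonneg hC₂0 (sq_nonneg (n : ℝ))]
  have hR1 : 1 ≤ Real.exp (2 * (E * n)) := Real.one_le_exp (by positivity)
  have htwo : ∀ t : ℝ, 2 * Real.exp t ≤ Real.exp (1 + t) := by
    intro t
    rw [Real.exp_add]
    have := Real.add_one_le_exp (1 : ℝ)
    gcongr
    linarith
  have hfinal : (2 * Real.exp (F * (n : ℝ) ^ 2)) ^ d * (2 * Real.exp (2 * (E * n))) ^ n *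
      ‖(1 : Matrix (Fin d) (Fin d) K)‖ ≤
      Real.exp ((d * (1 + F) + (1 + 2 * E) + c) * (n : ℝ) ^ 2) := by
    calc _ ≤ (Real.exp (1 + F * (n : ℝ) ^ 2)) ^ d * (Real.exp (1 + 2 * (E * n))) ^ n *
          Real.exp c := by
          gcongr
          · exact htwo _
          · exact htwo _
      _ = Real.exp (d * (1 + F * (n : ℝ) ^ 2) + n * (1 + 2 * (E * n)) + c) := by
          rw [← Real.exp_nat_mul, ← Real.exp_nat_mul, ← Real.exp_add, ← Real.exp_add]
      _ ≤ _ := by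
          rw [Real.exp_le_exp]
          have hd : (0 : ℝ) ≤ d := by positivity
          nlinarith [mul_nonneg hd (sub_nonneg.2 hn3), mul_nonneg hc0 (sub_nonneg.2 hn3)]
  intro i j
  constructor
  · refine (norm_entry_le _ i j).trans (le_trans ?_ hfinal)
    rw [map_pow, Units.val_pow_eq_pow_val]
    refine norm_pow_le_of_eigenvalues
      ((norm_le_exp_logNorm ρ x).trans (Real.exp_le_exp.2 hxQ)) hR1 hRQ ?_ n
    intro μ v hv h
    exact (mulVec_eigenvalue_bounds hD ρ hv h hxR).1
  · refine (norm_entry_le _ i j).trans (le_trans ?_ hfinal)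
    rw [← inv_pow, map_pow, Units.val_pow_eq_pow_val]
    refine norm_pow_le_of_eigenvalues
      ((norm_le_exp_logNorm ρ x⁻¹).trans (Real.exp_le_exp.2 (by rwa [logNorm_inv]))) hR1 hRQ ?_ n
    intro μ v hv h
    rw [map_inv] at h
    have h2 := (inv_mulVec_eq_smul hv h).2
    rw [inv_inv] at h2
    simpa using (mulVec_eigenvalue_bounds hD ρ hv h2 hxR).2

end

end FibreProduct

/-! ### From matrix entries to Cartan projections. -/

section Cartan

theorem norm_euclidean_le_of_norm_le {k : Type*} [RCLike k] {d : ℕ} (x : EuclideanSpace k (Fin d))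
    {B : ℝ} (h : ∀ i, ‖x i‖ ≤ B) : ‖x‖ ≤ d * B := by
  have h1 : x = ∑ i, x i • EuclideanSpace.single i (1 : k) := by
    ext j
    simp [Finset.sum_apply, Pi.single_apply]
  rw [h1]
  refine (norm_sum_le _ _).trans ?_
  calc ∑ i, ‖x i • EuclideanSpace.single i (1 : k)‖ ≤ ∑ _i : Fin d, B := by
        refine Finset.sum_le_sum fun i _ => ?_
        rw [norm_smul, PiLp.norm_single, norm_one, mul_one]
        exact h i
    _ = d * B := by simp

theorem norm_toEuclideanLin_le {k : Type*} [RCLike k] {d : ℕ} (A : Matrix (Fin d) (Fin d) k)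
    {E : ℝ} (hE : 0 ≤ E) (hA : ∀ i j, ‖A i j‖ ≤ E) (v : EuclideanSpace k (Fin d)) :
    ‖Matrix.toEuclideanLin A v‖ ≤ d * (d * E) * ‖v‖ := by
  have h1 : ∀ i, ‖(Matrix.toEuclideanLin A v) i‖ ≤ d * E * ‖v‖ := by
    intro i
    have h2 : (Matrix.toEuclideanLin A v) i = ∑ j, A i j * v j := rfl
    rw [h2]
    refine (norm_sum_le _ _).trans ?_
    calc ∑ j, ‖A i j * v j‖ ≤ ∑ _j : Fin d, E * ‖v‖ := by
          refine Finset.sum_le_sum fun j _ => ?_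
          rw [norm_mul]
          exact mul_le_mul (hA i j) (PiLp.norm_apply_le v j) (norm_nonneg _) hE
      _ = d * E * ‖v‖ := by simp; ring
  refine (norm_euclidean_le_of_norm_le _ h1).trans (le_of_eq ?_)
  ring

/-- A singular vector is stretched by exactly σ: the entries of g bound σ above, those of g⁻¹ bound
it below. The term 2d comes from d² ≤ exp(2d). -/
theorem norm_cartanProjArch_le {k : Type*} [RCLike k] {d : ℕ} (g : GL (Fin d) k) {E : ℝ}
    (hg : ∀ i j, ‖(g : Matrix (Fin d) (Fin d) k) i j‖ ≤ Real.exp E)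
    (hg' : ∀ i j, ‖((g⁻¹ : GL (Fin d) k) : Matrix (Fin d) (Fin d) k) i j‖ ≤ Real.exp E) :
    ‖cartanProjArch g‖ ≤ d * (2 * d + E) := by
  refine norm_euclidean_le_of_norm_le _ fun i => ?_
  change |Real.log _| ≤ _
  set T := Matrix.toEuclideanLin (g : Matrix (Fin d) (Fin d) k) with hT
  set s := T.singularValues i with hs
  have hs0 : 0 ≤ s := T.singularValues_nonneg _
  have hdim : (i : ℕ) < Module.finrank k (EuclideanSpace k (Fin d)) := by simp
  obtain ⟨v, hv⟩ := (T.hasEigenvalue_adjoint_comp_self_sq_singularValues hdim).exists_hasEigenvector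
  have hv0 : 0 < ‖v‖ := norm_pos_iff.2 hv.2
  have hTv : ‖T v‖ = s * ‖v‖ := by
    have h1 : inner k (T v) (T v) = inner k (LinearMap.adjoint T (T v)) v := by
      rw [LinearMap.adjoint_inner_left]
    have h2 : LinearMap.adjoint T (T v) = ((s : k) ^ 2) • v :=
      Module.End.mem_eigenspace_iff.1 hv.1
    rw [h2, inner_smul_left, inner_self_eq_norm_sq_to_K, inner_self_eq_norm_sq_to_K] at h1
    have h3 : ‖T v‖ ^ 2 = s ^ 2 * ‖v‖ ^ 2 := by
      simp only [map_pow, RCLike.conj_ofReal] at h1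
      exact_mod_cast h1
    rw [← mul_pow] at h3
    exact (pow_left_inj₀ (norm_nonneg _) (by positivity) two_ne_zero).1 h3
  have hdd : (d : ℝ) * (d * Real.exp E) ≤ Real.exp (2 * d + E) := by
    have h1 : (d : ℝ) ≤ Real.exp d := by linarith [Real.add_one_le_exp (d : ℝ)]
    calc (d : ℝ) * (d * Real.exp E) ≤ Real.exp d * (Real.exp d * Real.exp E) := by gcongr
      _ = _ := by rw [← Real.exp_add, ← Real.exp_add]; congr 1; ring
  have hle : s ≤ Real.exp (2 * d + E) := by
    have h1 := norm_toEuclideanLin_le _ (Real.exp_nonneg E) hg v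
    rw [← hT, hTv] at h1
    exact (le_of_mul_le_mul_right h1 hv0).trans hdd
  have hge : 1 ≤ Real.exp (2 * d + E) * s := by
    have h1 := norm_toEuclideanLin_le _ (Real.exp_nonneg E) hg' (T v)
    have h2 : Matrix.toEuclideanLin ((g⁻¹ : GL (Fin d) k) : Matrix (Fin d) (Fin d) k) (T v) = v := by
      ext j
      change (((g⁻¹ : GL (Fin d) k) : Matrix (Fin d) (Fin d) k).mulVec
        ((g : Matrix (Fin d) (Fin d) k).mulVec v.ofLp)) j = _
      rw [Matrix.mulVec_mulVec, ← Units.val_mul, inv_mul_cancel, Units.val_one, Matrix.one_mulVec]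
    rw [h2, hTv, ← mul_assoc] at h1
    have h3 : 1 ≤ d * (d * Real.exp E) * s :=
      le_of_mul_le_mul_right (by rwa [one_mul]) hv0
    exact h3.trans (by gcongr)
  have hspos : 0 < s := by
    by_contra! h
    have : s = 0 := le_antisymm h hs0
    rw [this, mul_zero] at hge
    linarith
  rw [abs_le]
  constructor
  · have h1 : Real.exp (-(2 * d + E)) ≤ s := by
      rw [Real.exp_neg, inv_le_iff_one_le_mul₀' (Real.exp_pos _)]
      exact hge
    exact (Real.le_log_iff_exp_le hspos).2 h1
  · exact (Real.log_le_iff_le_exp hspos).2 hle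

/-- Eigenvalue arguments need an algebraically closed field; an isometric embedding treats ℝ and ℂ
together. -/
theorem exists_ringHom_complex (k : Type*) [RCLike k] :
    ∃ ι : k →+* ℂ, ∀ x, ‖ι x‖ = ‖x‖ := by
  rcases RCLike.I_eq_zero_or_im_I_eq_one (K := k) with h | h
  · refine ⟨(algebraMap ℝ ℂ).comp (RCLike.realRingEquiv h).toRingHom, fun x => ?_⟩
    simp only [RingHom.comp_apply]
    rw [norm_algebraMap']
    have hx : x = ((RCLike.re x : ℝ) : k) := ((RCLike.realRingEquiv h).symm_apply_apply x).symm
    change ‖RCLike.re x‖ = ‖x‖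
    conv_rhs => rw [hx, RCLike.norm_ofReal]
    rfl
  · refine ⟨(RCLike.complexRingEquiv h).toRingHom, fun x => ?_⟩
    have h1 : ‖(RCLike.complexRingEquiv h) x‖ ^ 2 = ‖x‖ ^ 2 := by
      rw [← Complex.normSq_eq_norm_sq, ← RCLike.normSq_eq_def', Complex.normSq_apply,
        RCLike.normSq_apply]
      simp
    exact (pow_left_inj₀ (norm_nonneg _) (norm_nonneg _) two_ne_zero).1 h1

theorem norm_entry_mul_mul_le {k K : Type*} [Field k] [NormedField K] (ι : k →+* K) {d : ℕ}
    {A B C : Matrix (Fin d) (Fin d) k} {e : ℝ} (hA : ∀ i j, ‖ι (A i j)‖ ≤ 1)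
    (hB : ∀ i j, ‖ι (B i j)‖ ≤ e) (hC : ∀ i j, ‖ι (C i j)‖ ≤ 1) (he : 0 ≤ e) (i j : Fin d) :
    ‖ι ((A * B * C) i j)‖ ≤ d * (d * e) := by
  simp only [Matrix.mul_apply, map_sum, map_mul]
  calc ‖∑ l, (∑ l', ι (A i l') * ι (B l' l)) * ι (C l j)‖
      ≤ ∑ _l : Fin d, (∑ _l' : Fin d, 1 * e) * 1 := by
        refine norm_sum_le_of_le _ fun l _ => ?_
        rw [norm_mul]
        refine mul_le_mul (norm_sum_le_of_le _ fun l' _ => ?_) (hC l j) (norm_nonneg _)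
          (by positivity)
        rw [norm_mul]
        exact mul_le_mul (hA i l') (hB l' l) (norm_nonneg _) zero_le_one
    _ = d * (d * e) := by simp

section NonArchimedean

universe u

variable (k : Type u) [Field k] [ValuativeRel k] [TopologicalSpace k]
  [IsNonarchimedeanLocalField k]

/-- A non-Archimedean local field embeds in an algebraically closed field with an absolute value
that induces its valuation. -/
theorem exists_isAlgClosed_normedField :
    ∃ (K : Type u) (_ : NormedField K) (_ : IsAlgClosed K) (ι : k →+* K),
      (∀ x : 𝒪[k], ‖ι x‖ ≤ 1) ∧ ∀ τ : 𝒪[k], Irreducible τ → ‖ι τ‖ < 1 := by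
  let _ := IsTopologicalAddGroup.rightUniformSpace k
  have _ := isUniformAddGroup_of_addCommGroup (G := k)
  let _ : (Valued.v (R := k)).RankOne :=
    { hom' := ValuativeRel.IsRankLeOne.nonempty.some.emb (R := k).comp
        MonoidWithZeroHom.ValueGroup₀.embedding
      strictMono' := ValuativeRel.IsRankLeOne.nonempty.some.strictMono.comp
        MonoidWithZeroHom.ValueGroup₀.embedding_strictMono }
  have hcomplete : CompleteSpace k := inferInstance
  open scoped Valued in
  let _ : NontriviallyNormedField k := inferInstance
  have _ : IsUltrametricDist k := inferInstance
  let _ : NormedField (AlgebraicClosure k) := spectralNorm.normedField k (AlgebraicClosure k)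
  refine ⟨AlgebraicClosure k, inferInstance, inferInstance, algebraMap k _, ?_, ?_⟩
  · intro x
    have h1 : ‖algebraMap k (AlgebraicClosure k) x‖ = ‖(x : k)‖ := spectralNorm_extends _
    rw [h1, Valued.toNormedField.norm_le_one_iff]
    exact x.2
  · intro τ hτ
    have h1 : ‖algebraMap k (AlgebraicClosure k) τ‖ = ‖(τ : k)‖ := spectralNorm_extends _
    rw [h1, Valued.toNormedField.norm_lt_one_iff]
    refine lt_of_le_of_ne τ.2 fun h => hτ.not_isUnit ?_
    have h2 : (τ : k)⁻¹ ∈ (ValuativeRel.valuation k).integer := by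
      change ValuativeRel.valuation k (τ : k)⁻¹ ≤ 1
      rw [map_inv₀, show ValuativeRel.valuation k (τ : k) = 1 from h, inv_one]
    have h0 : (τ : k) ≠ 0 := fun h => hτ.ne_zero (Subtype.ext h)
    exact IsUnit.of_mul_eq_one ⟨_, h2⟩ (Subtype.ext (mul_inv_cancel₀ h0))

variable {k}

theorem exists_norm_cartanProjNonarch_le {K : Type*} [NormedField K] (ι : k →+* K)
    (hι : ∀ x : 𝒪[k], ‖ι x‖ ≤ 1) (hτ : ∀ τ : 𝒪[k], Irreducible τ → ‖ι τ‖ < 1) (d : ℕ) :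
    ∃ c : ℝ, 0 ≤ c ∧ ∀ (g : GL (Fin d) k) (E : ℝ),
      (∀ i j, ‖ι ((g : Matrix (Fin d) (Fin d) k) i j)‖ ≤ Real.exp E) →
      (∀ i j, ‖ι (((g⁻¹ : GL (Fin d) k) : Matrix (Fin d) (Fin d) k) i j)‖ ≤ Real.exp E) →
      ‖cartanProjNonarch g‖ ≤ c * (2 * d + E) := by
  obtain ⟨τ₀, hτ₀⟩ := IsDiscreteValuationRing.exists_irreducible 𝒪[k]
  set θ := ‖ι τ₀‖ with hθ
  have hθ1 : θ < 1 := hτ τ₀ hτ₀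
  have hθ0 : 0 < θ := by
    rw [hθ, norm_pos_iff, map_ne_zero]
    exact fun h => hτ₀.ne_zero (Subtype.ext h)
  have hlog : Real.log θ < 0 := Real.log_neg hθ0 hθ1
  have hunit : ∀ τ : 𝒪[k], Irreducible τ → ‖ι τ‖ = θ := by
    have key : ∀ τ τ' : 𝒪[k], Irreducible τ → Irreducible τ' → ‖ι τ'‖ ≤ ‖ι τ‖ := by
      intro τ τ' h h'
      obtain ⟨x, hx⟩ := (IsDiscreteValuationRing.associated_of_irreducible 𝒪[k] h h').dvd
      rw [hx]
      simp only [MulMemClass.coe_mul, map_mul, norm_mul]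
      exact mul_le_of_le_one_right (norm_nonneg _) (hι x)
    exact fun τ h => le_antisymm (key _ _ hτ₀ h) (key _ _ h hτ₀)
  have hint : ∀ (a : GL (Fin d) 𝒪[k]) (i j : Fin d),
      ‖ι ((Matrix.GeneralLinearGroup.map (algebraMap 𝒪[k] k) a : Matrix (Fin d) (Fin d) k) i j)‖ ≤ 1 :=
    fun a i j => hι _
  set q : ℝ := (Nat.card 𝓀[k] : ℝ) with hq
  -- The ratio converts powers of θ into powers of q; only 0 < θ < 1 is used, not the value of θ.
  -- The factor d bounds a Euclidean norm by its coordinates.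
  refine ⟨d * (|Real.log q| / |Real.log θ|), by positivity, fun g E hg hg' => ?_⟩
  obtain ⟨-, τ, hτi, a, b, hab⟩ : IsCartanExponents g (cartanExponents g) :=
    (exists_isCartanExponents g).choose_spec
  set n := cartanExponents g with hn
  rw [mul_assoc]
  refine norm_euclidean_le_of_norm_le _ fun i => ?_
  change |Real.log (q ^ (-n i))| ≤ _
  have hτ0 : (τ : k) ≠ 0 := fun h => hτi.ne_zero (Subtype.ext h)
  set a' := Matrix.GeneralLinearGroup.map (algebraMap 𝒪[k] k) a with ha'
  set b' := Matrix.GeneralLinearGroup.map (algebraMap 𝒪[k] k) b with hb'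
  let t : GL (Fin d) k :=
    ⟨Matrix.diagonal (fun i => (τ : k) ^ n i), Matrix.diagonal (fun i => (τ : k) ^ (-n i)),
      by rw [Matrix.diagonal_mul_diagonal, ← Matrix.diagonal_one]; congr 1; ext i
         rw [← zpow_add₀ hτ0, add_neg_cancel, zpow_zero],
      by rw [Matrix.diagonal_mul_diagonal, ← Matrix.diagonal_one]; congr 1; ext i
         rw [← zpow_add₀ hτ0, neg_add_cancel, zpow_zero]⟩
  have hgt : g = a' * t * b' := Units.ext hab
  have ht : t = a'⁻¹ * g * b'⁻¹ := by rw [hgt]; group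
  have ht' : t⁻¹ = b' * g⁻¹ * a' := by rw [hgt]; group
  have hdd : (d : ℝ) * (d * Real.exp E) ≤ Real.exp (2 * d + E) := by
    have h1 : (d : ℝ) ≤ Real.exp d := by linarith [Real.add_one_le_exp (d : ℝ)]
    calc (d : ℝ) * (d * Real.exp E) ≤ Real.exp d * (Real.exp d * Real.exp E) := by gcongr
      _ = _ := by rw [← Real.exp_add, ← Real.exp_add]; congr 1; ring
  -- The diagonal factor is g multiplied by integral matrices, whose entries have norm at most 1.
  have k1 : θ ^ n i ≤ Real.exp (2 * d + E) := by
    have h1 := norm_entry_mul_mul_le ι (hint a⁻¹) hg (hint b⁻¹) (Real.exp_nonneg E) i i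
    rw [map_inv, map_inv, ← Units.val_mul, ← Units.val_mul, ← ha', ← hb', ← ht] at h1
    refine le_trans (le_of_eq ?_) (h1.trans hdd)
    rw [← hunit τ hτi, ← norm_zpow, ← map_zpow₀]
    simp [t]
  have k2 : θ ^ (-n i) ≤ Real.exp (2 * d + E) := by
    have h1 := norm_entry_mul_mul_le ι (hint b) hg' (hint a) (Real.exp_nonneg E) i i
    rw [← Units.val_mul, ← Units.val_mul, ← ha', ← hb', ← ht'] at h1
    refine le_trans (le_of_eq ?_) (h1.trans hdd)
    rw [← hunit τ hτi, ← norm_zpow, ← map_zpow₀]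
    have : ((t⁻¹ : GL (Fin d) k) : Matrix (Fin d) (Fin d) k) =
      Matrix.diagonal (fun i => (τ : k) ^ (-n i)) := rfl
    rw [this, Matrix.diagonal_apply_eq]
  rw [← Real.log_le_iff_le_exp (zpow_pos hθ0 _), Real.log_zpow] at k1 k2
  push_cast at k2
  have k3 : |(n i : ℝ)| * |Real.log θ| ≤ 2 * d + E := by
    rw [← abs_mul, abs_le]
    constructor <;> linarith
  rw [Real.log_zpow, abs_mul]
  push_cast
  rw [abs_neg, div_mul_eq_mul_div, le_div_iff₀ (abs_pos.2 hlog.ne)]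
  calc |(n i : ℝ)| * |Real.log q| * |Real.log θ| = |Real.log q| * (|(n i : ℝ)| * |Real.log θ|) := by
        ring
    _ ≤ _ := by gcongr

end NonArchimedean

end Cartan

/-! ### Cubic lower bound for the word length. -/

section Growth

variable {Γ : Type*} [Group Γ]

/-- A word that represents the first component of `twoSquares φ a b D n`. -/
def twoSquaresWord (a b : Γ) (D n : ℕ) : List Γ :=
  List.replicate n a ++ List.replicate n b ++ List.replicate n a⁻¹ ++ List.replicate n b⁻¹ ++
    List.replicate (D * n) a⁻¹ ++
    (List.replicate n b ++ List.replicate n a ++ List.replicate n b⁻¹ ++ List.replicate n a⁻¹) ++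
    List.replicate (D * n) a

theorem prod_twoSquaresWord {Q : Type*} [CommGroup Q] (φ : Γ →* Q) (a b : Γ) (D n : ℕ) :
    (twoSquaresWord a b D n).prod = (twoSquares φ a b D n).1.1 := by
  simp [twoSquaresWord, twoSquares, rectangle, mul_assoc]

theorem length_twoSquaresWord (a b : Γ) (D n : ℕ) :
    (twoSquaresWord a b D n).length = (8 + 2 * D) * n := by
  simp only [twoSquaresWord, List.length_append, List.length_replicate]
  ring

theorem mem_twoSquaresWord {a b x : Γ} {D n : ℕ} (hx : x ∈ twoSquaresWord a b D n) :
    x ∈ ({a, b, a⁻¹, b⁻¹} : Set Γ) := by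
  simp only [twoSquaresWord, List.mem_append, List.mem_replicate] at hx
  simp only [Set.mem_insert_iff, Set.mem_singleton_iff]
  tauto

variable {X Y : Γ → ℤ}

theorem additive_map_inv (hX : ∀ g h, X (g * h) = X g + X h) (g : Γ) : X g⁻¹ = -X g := by
  have := hX g g⁻¹
  rw [mul_inv_cancel, map_one_of_additive hX] at this
  omega

theorem additive_map_pow (hX : ∀ g h, X (g * h) = X g + X h) (g : Γ) (n : ℕ) :
    X (g ^ n) = n * X g := by
  induction n with
  | zero => simp [map_one_of_additive hX]
  | succ n ih => rw [pow_succ, hX, ih]; push_cast; ring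

/-- The first square lies in x ≥ 0, and the second, oppositely oriented, in x ≤ 0 because D ≥ 1. The
weight |x| therefore counts n² for each. -/
theorem areaSum_twoSquaresWord (hX : ∀ g h, X (g * h) = X g + X h)
    (hY : ∀ g h, Y (g * h) = Y g + Y h) {a b : Γ} (hXa : X a = 1) (hXb : X b = 0)
    (hYa : Y a = 0) (hYb : Y b = 1) {D : ℕ} (hD : 1 ≤ D) (n : ℕ) :
    areaSum X Y 0 (twoSquaresWord a b D n) = 2 * (n : ℤ) ^ 2 := by
  have hXa' : X a⁻¹ = -1 := by rw [additive_map_inv hX, hXa]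
  have hXb' : X b⁻¹ = 0 := by rw [additive_map_inv hX, hXb, neg_zero]
  have hYa' : Y a⁻¹ = 0 := by rw [additive_map_inv hY, hYa, neg_zero]
  have hYb' : Y b⁻¹ = -1 := by rw [additive_map_inv hY, hYb]
  have hDn : (n : ℤ) ≤ D * n := by
    have : (1 : ℤ) ≤ D := by exact_mod_cast hD
    nlinarith [Int.natCast_nonneg n]
  simp only [twoSquaresWord, areaSum_append hX, areaSum_replicate_of_horizontal hYa,
    areaSum_replicate_of_horizontal hYa', areaSum_replicate_of_vertical hXb,
    areaSum_replicate_of_vertical hXb', List.prod_append, List.prod_replicate, hX,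
    additive_map_pow hX, hXa, hXb, hXa', hXb', hYb, hYb']
  push_cast
  have e1 : |(0 : ℤ) + n * 1| = n := by simp
  have e2 : |(0 : ℤ) + (n * 1 + n * 0 + n * -1)| = 0 := by simp
  have e3 : |(0 : ℤ) + (n * 1 + n * 0 + n * -1 + n * 0 + D * n * -1)| = D * n := by
    rw [abs_of_nonpos (by nlinarith [Int.natCast_nonneg n])]; ring
  have e4 : |(0 : ℤ) + (n * 1 + n * 0 + n * -1 + n * 0 + D * n * -1) + (n * 0 + n * 1)| =
      D * n - n := by
    rw [abs_of_nonpos (by nlinarith)]; ring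
  rw [e1, e2, e3, e4]
  ring

theorem exists_le_wordLength_twoSquares_pow {Q : Type*} [CommGroup Q] (hΓ : IsGromovHyperbolic Γ)
    (φ : Γ →* Q) (hX : ∀ g h, X (g * h) = X g + X h)
    (hY : ∀ g h, Y (g * h) = Y g + Y h) (hXφ : ∀ g h, φ g = φ h → X g = X h)
    (hYφ : ∀ g h, φ g = φ h → Y g = Y h) {a b : Γ} (hXa : X a = 1) (hXb : X b = 0)
    (hYa : Y a = 0) (hYb : Y b = 1) {D : ℕ} (hD : 1 ≤ D) {S : Set (fibreProduct φ)}
    (hSf : S.Finite) (hS : Subgroup.closure S = ⊤) :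
    ∃ C : ℕ, ∀ n : ℕ,
      2 * n ^ 3 ≤ C * (wordLength S (twoSquares φ a b D n ^ n) + (8 + 2 * D) * n ^ 2) := by
  obtain ⟨C, hC0, hC⟩ := exists_abs_areaSum_le_wordLength hΓ hX hY
    (P := fibreProduct φ) (fun p => hXφ _ _ p.2) (fun p => hYφ _ _ p.2) hSf hS
    (T := {a, b, a⁻¹, b⁻¹}) (Set.toFinite _)
  refine ⟨C.toNat, fun n => ?_⟩
  have h1 := hC (twoSquares φ a b D n ^ n) (List.replicate n (twoSquaresWord a b D n)).flatten
    (by simp [twoSquares])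
    (fun x hx => by
      obtain ⟨l, hl, hxl⟩ := List.mem_flatten.1 hx
      rw [List.eq_of_mem_replicate hl] at hxl
      exact mem_twoSquaresWord hxl)
    (by
      rw [List.prod_flatten, List.map_replicate, List.prod_replicate, prod_twoSquaresWord φ]
      simp)
  have hu : X (twoSquaresWord a b D n).prod = 0 := by
    rw [prod_twoSquaresWord φ]
    refine (hXφ _ _ (twoSquares φ a b D n).2).trans ?_
    have : (twoSquares φ a b D n).1.2 = 1 := by simp [twoSquares]
    change X (twoSquares φ a b D n).1.2 = 0
    rw [this, map_one_of_additive hX]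
  rw [areaSum_flatten_replicate hX hu,
    areaSum_twoSquaresWord hX hY hXa hXb hYa hYb hD, List.length_flatten, List.map_replicate,
    List.sum_replicate, length_twoSquaresWord, abs_of_nonneg (by positivity)] at h1
  zify
  rw [Int.toNat_of_nonneg hC0]
  refine le_trans (le_of_eq (by ring)) (h1.trans (le_of_eq ?_))
  push_cast [smul_eq_mul]
  ring

theorem one_le_wordLength {G : Type*} [Group G] {S : Set G} (hS : Subgroup.closure S = ⊤) {g : G}
    (hg : g ≠ 1) : 1 ≤ wordLength S g := by
  obtain ⟨l, hlen, -, rfl⟩ := exists_list_length_eq_wordLength hS g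
  rw [← hlen]
  by_contra! h
  have : l = [] := List.eq_nil_of_length_eq_zero (by omega)
  exact hg (by simp [this])

theorem wordLength_one {G : Type*} [Group G] (S : Set G) : wordLength S (1 : G) = 0 := by
  have := wordLength_prod_le (S := S) ([] : List G) (by simp)
  simpa using this

/-- For n ≥ CE the quadratic term is absorbed by one of the two cubes; smaller n are covered by L ≥
1. -/
theorem cube_le_of_le_add {n L C E : ℕ} (h : 2 * n ^ 3 ≤ C * (L + E * n ^ 2)) (hL : 1 ≤ L) :
    n ^ 3 ≤ (C + (C * E) ^ 3) * L := by
  rcases le_total n (C * E) with h1 | h1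
  · calc n ^ 3 ≤ (C * E) ^ 3 := Nat.pow_le_pow_left h1 3
      _ ≤ C + (C * E) ^ 3 := Nat.le_add_left _ _
      _ ≤ (C + (C * E) ^ 3) * L := Nat.le_mul_of_pos_right _ hL
  · have h2 : C * E * n ^ 2 ≤ n * n ^ 2 := Nat.mul_le_mul_right _ h1
    have h3 : 0 ≤ (C * E) ^ 3 * L := Nat.zero_le _
    nlinarith

theorem sq_le_rpow_of_cube_le {n C L d : ℕ} (h : n ^ 3 ≤ C * L) (hL : 1 ≤ L) :
    (n : ℝ) ^ 2 ≤ (C : ℝ) ^ (2 / 3 : ℝ) * (L : ℝ) ^ (1 - 1 / (2 * (d : ℝ) + 3)) := by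
  have h1 : (n : ℝ) ^ 2 = ((n : ℝ) ^ 3) ^ (2 / 3 : ℝ) := by
    rw [← Real.rpow_natCast_mul (by positivity), ← Real.rpow_natCast]
    norm_num
  have h2 : (n : ℝ) ^ 3 ≤ C * L := by exact_mod_cast h
  have h3 : (1 : ℝ) ≤ L := by exact_mod_cast hL
  have h4 : (2 / 3 : ℝ) ≤ 1 - 1 / (2 * (d : ℝ) + 3) := by
    have : 1 / (2 * (d : ℝ) + 3) ≤ 1 / 3 := by
      apply one_div_le_one_div_of_le (by norm_num)
      have : (0 : ℝ) ≤ d := by positivity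
      linarith
    linarith
  rw [h1]
  calc ((n : ℝ) ^ 3) ^ (2 / 3 : ℝ) ≤ ((C : ℝ) * L) ^ (2 / 3 : ℝ) := by gcongr
    _ = (C : ℝ) ^ (2 / 3 : ℝ) * (L : ℝ) ^ (2 / 3 : ℝ) :=
        Real.mul_rpow (by positivity) (by positivity)
    _ ≤ _ := by gcongr

end Growth

/-! ### Assembly of the two estimates. -/

theorem mainTheorem3 {Γ : Type*} [Group Γ] (hΓ : IsGromovHyperbolic Γ)
    (m : ℕ) (hm : 2 ≤ m) (φ : Γ →* Multiplicative (Fin m → ℤ))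
    (hφ : Function.Surjective φ) (hker : φ.ker.FG) :
    Group.FG (fibreProduct φ) ∧
    ∀ d : ℕ, ∃ w : ℕ → fibreProduct φ,
      ∀ S : Set (fibreProduct φ), S.Finite → Subgroup.closure S = ⊤ →
        Filter.Tendsto (fun n => wordLength S (w n)) Filter.atTop Filter.atTop ∧
        (∀ (k : Type*) [RCLike k] (ρ : fibreProduct φ →* GL (Fin d) k),
          ∃ C : ℝ, 0 < C ∧ ∀ n : ℕ, ‖cartanProjArch (ρ (w n))‖ ≤
            C * (wordLength S (w n) : ℝ) ^ (1 - 1 / (2 * (d : ℝ) + 3))) ∧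
        (∀ (k : Type*) [Field k] [ValuativeRel k] [TopologicalSpace k]
            [IsNonarchimedeanLocalField k] (ρ : fibreProduct φ →* GL (Fin d) k),
          ∃ C : ℝ, 0 < C ∧ ∀ n : ℕ, ‖cartanProjNonarch (ρ (w n))‖ ≤
            C * (wordLength S (w n) : ℝ) ^ (1 - 1 / (2 * (d : ℝ) + 3))) := by
  have hFG : Group.FG Γ := by
    obtain ⟨S, hSf, hS, -⟩ := hΓ
    exact Group.fg_iff.2 ⟨S, hS, hSf⟩
  have hP := fibreProduct_fg φ hker
  refine ⟨hP, fun d => ?_⟩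
  let i₀ : Fin m := ⟨0, by omega⟩
  let i₁ : Fin m := ⟨1, by omega⟩
  have hi : i₀ ≠ i₁ := by simp [i₀, i₁]
  obtain ⟨a, ha⟩ := hφ (Multiplicative.ofAdd (Pi.single i₀ 1))
  obtain ⟨b, hb⟩ := hφ (Multiplicative.ofAdd (Pi.single i₁ 1))
  let X : Γ → ℤ := fun g => (φ g).toAdd i₀
  let Y : Γ → ℤ := fun g => (φ g).toAdd i₁
  have hX : ∀ g h, X (g * h) = X g + X h := fun g h => by simp [X]
  have hY : ∀ g h, Y (g * h) = Y g + Y h := fun g h => by simp [Y]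
  have hXa : X a = 1 := by simp [X, ha]
  have hXb : X b = 0 := by simp [X, hb, hi]
  have hYa : Y a = 0 := by simp [Y, ha, hi.symm]
  have hYb : Y b = 1 := by simp [Y, hb]
  have hD : ∀ i, 1 ≤ i → i ≤ d → i ∣ d.factorial := fun i h1 h2 => Nat.dvd_factorial h1 h2
  set D := d.factorial
  have hD1 : 1 ≤ D := d.factorial_pos
  have hlower := fun (S : Set (fibreProduct φ)) (hSf : S.Finite) (hS : Subgroup.closure S = ⊤) =>
    exists_le_wordLength_twoSquares_pow hΓ φ hX hY (fun g h e => by simp only [X, e])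
      (fun g h e => by simp only [Y, e]) hXa hXb hYa hYb hD1 hSf hS
  -- The shift N discards trivial elements, so that all word lengths are at least 1. One generating
  -- set suffices to find N, as triviality does not depend on it.
  obtain ⟨N, hN1, hN⟩ : ∃ N : ℕ, 1 ≤ N ∧ ∀ n, N ≤ n → twoSquares φ a b D n ^ n ≠ 1 := by
    obtain ⟨S, hS, hSf⟩ := Group.fg_iff.1 hP
    obtain ⟨C, hC⟩ := hlower S hSf hS
    refine ⟨C * (8 + 2 * D) + 1, by omega, fun n hn h => ?_⟩
    have h1 := hC n
    rw [h, wordLength_one, zero_add, ← mul_assoc] at h1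
    have h2 : C * (8 + 2 * D) * n ^ 2 < n * n ^ 2 :=
      Nat.mul_lt_mul_of_pos_right (by omega) (pow_pos (by omega) 2)
    have h3 : n * n ^ 2 = n ^ 3 := by ring
    omega
  refine ⟨fun n => twoSquares φ a b D (n + N) ^ (n + N), fun S hSf hS => ?_⟩
  obtain ⟨C, hC⟩ := hlower S hSf hS
  have hL1 : ∀ n, 1 ≤ wordLength S (twoSquares φ a b D (n + N) ^ (n + N)) := fun n =>
    one_le_wordLength hS (hN _ (by omega))
  have hcube := fun n => cube_le_of_le_add (hC (n + N)) (hL1 n)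
  set B := C + (C * (8 + 2 * D)) ^ 3
  have hbound : ∀ (c F : ℝ) (f : ℕ → ℝ), 0 ≤ c → 0 ≤ F →
      (∀ n, f n ≤ c * (2 * d + F * ((n + N : ℕ) : ℝ) ^ 2)) →
      ∃ C : ℝ, 0 < C ∧ ∀ n, f n ≤
        C * (wordLength S (twoSquares φ a b D (n + N) ^ (n + N)) : ℝ) ^
          (1 - 1 / (2 * (d : ℝ) + 3)) := by
    intro c F f hc hF hf
    refine ⟨c * (2 * d + F) * (B : ℝ) ^ (2 / 3 : ℝ) + 1, by positivity, fun n => ?_⟩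
    have h1 := sq_le_rpow_of_cube_le (d := d) (hcube n) (hL1 n)
    have h2 : (1 : ℝ) ≤ ((n + N : ℕ) : ℝ) ^ 2 := by
      have : (1 : ℝ) ≤ ((n + N : ℕ) : ℝ) := by exact_mod_cast (by omega : 1 ≤ n + N)
      exact one_le_pow₀ this
    have h3 : (2 * d + F * ((n + N : ℕ) : ℝ) ^ 2) ≤ (2 * d + F) * ((n + N : ℕ) : ℝ) ^ 2 := by
      have hd : (0 : ℝ) ≤ d := by positivity
      nlinarith
    set Z := (wordLength S (twoSquares φ a b D (n + N) ^ (n + N)) : ℝ) ^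
      (1 - 1 / (2 * (d : ℝ) + 3))
    have hZ : 0 ≤ Z := by positivity
    calc f n ≤ c * ((2 * d + F) * ((n + N : ℕ) : ℝ) ^ 2) := (hf n).trans (by gcongr)
      _ ≤ c * ((2 * d + F) * ((B : ℝ) ^ (2 / 3 : ℝ) * Z)) := by gcongr
      _ ≤ _ := by linarith
  refine ⟨?_, ?_, ?_⟩
  · refine Filter.tendsto_atTop.2 fun M => ?_
    filter_upwards [Filter.eventually_gt_atTop (B * M)] with n hn
    have h1 : n ≤ (n + N) ^ 3 := (Nat.le_add_right n N).trans (Nat.le_self_pow (by norm_num) _)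
    by_contra! h2
    have h3 := hcube n
    have h4 := Nat.mul_le_mul_left B h2.le
    omega
  · intro k _ ρ
    obtain ⟨ι, hι⟩ := exists_ringHom_complex k
    obtain ⟨F, hF0, hF⟩ := exists_norm_entry_twoSquares_pow_le φ hD a b
      ((Matrix.GeneralLinearGroup.map ι).comp ρ)
    refine hbound d F _ (by positivity) hF0 fun n => ?_
    refine norm_cartanProjArch_le _ (fun i j => ?_) fun i j => ?_
    · rw [← hι]
      exact (hF (n + N) (by omega) i j).1
    · rw [← hι, ← map_inv]
      exact (hF (n + N) (by omega) i j).2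
  · intro k _ _ _ _ ρ
    obtain ⟨K, _, _, ι, hι, hτ⟩ := exists_isAlgClosed_normedField k
    obtain ⟨F, hF0, hF⟩ := exists_norm_entry_twoSquares_pow_le φ hD a b
      ((Matrix.GeneralLinearGroup.map ι).comp ρ)
    obtain ⟨c, hc0, hc⟩ := exists_norm_cartanProjNonarch_le ι hι hτ d
    refine hbound c F _ hc0 hF0 fun n => hc _ _ (fun i j => ?_) fun i j => ?_
    · exact (hF (n + N) (by omega) i j).1
    · rw [← map_inv]
      exact (hF (n + N) (by omega) i j).2
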